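/- The energy $E(G)$ of a finite simple graph $G$ is the sum of the absolute values of the eigenvalues (counted with multiplicity) of its adjacency matrix. Let $S_2$ be the star of order $2$ (that is, $K_2$), and let $Q$ be the graph of order $6$ obtained from $S_2$ by attaching two pendent edges to each of its two end vertices. **Theorem 2.5.** Up to isomorphism, $S_2$ and $Q$ are the only two trees $T$ with maximum degree $\Delta(T)\le 3$ for which $E(T)=n$, where $n$ is the order (number of vertices) of $T$. That is, a finite simple graph $T$ is a tree with $\Delta(T)\le 3$ and $E(T)=n$ if and only if $T\cong S_2$ or $T\cong Q$. -/

import Mathlib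

namespace GraphEnergy

/-- The energy of a finite simple graph: the sum of the absolute values of the eigenvalues
(with multiplicity) of its adjacency matrix. -/
noncomputable def energy {V : Type*} [Fintype V] [DecidableEq V] (G : SimpleGraph V)
    [DecidableRel G.Adj] : ℝ :=
  ∑ i, |(G.isHermitian_adjMatrix ℝ).eigenvalues i|

/-- The star of order two, that is, the complete graph on two vertices. -/
def S₂ : SimpleGraph (Fin 2) := ⊤

/-- The graph obtained from a single edge, here joining `0` and `1`, by attaching two pendent
edges to each of its two end vertices. -/
def Q : SimpleGraph (Fin 6) :=
  SimpleGraph.fromEdgeSet {s(0, 1), s(0, 2), s(0, 3), s(1, 4), s(1, 5)}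

end GraphEnergy

/-! Deleting an edge from a tree `T` leaves two trees whose energies add up to at most `E(T)`: the
sum of the absolute values of the eigenvalues of a symmetric matrix does not grow when its
off-diagonal blocks are erased (`absRootSum_add_le_fromBlocks`). So if one piece has energy at least
its order and the other has energy greater than its order, then `E(T) > n`.

A tree of maximum degree at most three, rooted at a vertex of degree at most one, is a binary tree
(`exists_binTree_iso`). Unless it is one of five small "thin" trees, it contains a minimal subtree
that is not thin, and this is one of eleven "blocks" (`exists_split_block`). Each block has energy
greater than its order, except `K₂`, where equality holds.

Strong induction on the order, applied to what remains after cutting off a block, shows that `E(T) >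
n` apart from eight rooted trees (`lt_en_or_exists_swapEquiv`): `K₁`, `P₃`, `K₁,₃` and a tree on
seven vertices, the second and fourth with two rootings each, which have energy below the order, and
`K₂` and `Q`, which attain it. If the remainder is itself exceptional, finitely many joins are left.
They are settled by the surplus of the block, or by bounding the roots of an explicit characteristic
polynomial through sign changes. -/

open Matrix Polynomial

namespace GraphEnergy

/-! ### Energy as a sum over the roots of the characteristic polynomial -/

/-- The sum of the absolute values of the real roots of a polynomial, with multiplicity. -/
noncomputable def absRootSum (p : ℝ[X]) : ℝ := (p.roots.map abs).sum

theorem sum_abs_eigenvalues_eq {n : Type*} [Fintype n] [DecidableEq n] {A : Matrix n n ℝ}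
    (hA : A.IsHermitian) : ∑ i, |hA.eigenvalues i| = absRootSum A.charpoly := by
  simp [absRootSum, hA.roots_charpoly_eq_eigenvalues]

theorem energy_eq_absRootSum {V : Type*} [Fintype V] [DecidableEq V] (G : SimpleGraph V)
    [DecidableRel G.Adj] : energy G = absRootSum (G.adjMatrix ℝ).charpoly :=
  sum_abs_eigenvalues_eq _

theorem energy_congr {V W : Type*} [Fintype V] [DecidableEq V] [Fintype W] [DecidableEq W]
    {G : SimpleGraph V} {H : SimpleGraph W} [DecidableRel G.Adj] [DecidableRel H.Adj]
    (e : G ≃g H) : energy G = energy H := by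
  rw [energy_eq_absRootSum, energy_eq_absRootSum, ← charpoly_reindex e.toEquiv]
  congr 2
  ext i j
  simp only [reindex_apply, submatrix_apply, SimpleGraph.adjMatrix_apply]
  congr 1
  have := e.symm.map_adj_iff (v := i) (w := j)
  exact propext this

/-! ### Pinching for real symmetric matrices -/

/-- The diagonal of an orthogonal conjugate of a real symmetric matrix has `ℓ¹` norm at most the
sum of the absolute values of the eigenvalues. -/
theorem sum_abs_diag_conj_le {n : Type*} [Fintype n] [DecidableEq n] {M W : Matrix n n ℝ}
    (hM : M.IsHermitian) (hW : Wᵀ * W = 1) :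
    ∑ j, |(Wᵀ * M * W) j j| ≤ absRootSum M.charpoly := by
  rw [← sum_abs_eigenvalues_eq hM]
  set V : Matrix n n ℝ := (hM.eigenvectorUnitary).1 with hV
  have hVV : V * Vᵀ = 1 := by
    have := Unitary.coe_mul_star_self hM.eigenvectorUnitary
    simpa [star_eq_conjTranspose] using this
  have hspec : M = V * diagonal hM.eigenvalues * Vᵀ := by
    have := hM.spectral_theorem
    rw [Unitary.conjStarAlgAut_apply] at this
    simpa [star_eq_conjTranspose, Function.comp_def] using this
  have hWW : W * Wᵀ = 1 := mul_eq_one_comm.mp hW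
  set Z := Wᵀ * V with hZ
  have hZZ : Zᵀ * Z = 1 := by
    apply mul_eq_one_comm.mp
    rw [hZ, transpose_mul, transpose_transpose, Matrix.mul_assoc, ← Matrix.mul_assoc V, hVV,
      Matrix.one_mul, hW]
  have hcol : ∀ i, ∑ j, Z j i ^ 2 = 1 := fun i => by
    have := congrFun (congrFun hZZ i) i
    simpa [Matrix.mul_apply, sq] using this
  have hdiag : ∀ j, (Wᵀ * M * W) j j = ∑ i, Z j i ^ 2 * hM.eigenvalues i := fun j => by
    have : Wᵀ * M * W = Z * diagonal hM.eigenvalues * Zᵀ := by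
      conv_lhs => rw [hspec]
      simp [hZ, Matrix.mul_assoc]
    rw [this, Matrix.mul_apply]
    refine Finset.sum_congr rfl fun i _ => ?_
    rw [mul_diagonal, transpose_apply]
    ring
  -- Each diagonal entry is an average of the eigenvalues with weights `Z j i ^ 2`; these weights
  -- also sum to one over `j`, since `Z` is orthogonal.
  calc ∑ j, |(Wᵀ * M * W) j j| ≤ ∑ j, ∑ i, Z j i ^ 2 * |hM.eigenvalues i| := by
        refine Finset.sum_le_sum fun j _ => ?_
        rw [hdiag]
        refine (Finset.abs_sum_le_sum_abs _ _).trans_eq (Finset.sum_congr rfl fun i _ => ?_)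
        rw [abs_mul, abs_of_nonneg (sq_nonneg _)]
    _ = ∑ i, |hM.eigenvalues i| := by
        rw [Finset.sum_comm]
        refine Finset.sum_congr rfl fun i _ => ?_
        rw [← Finset.sum_mul, hcol, one_mul]

/-- **Pinching**: deleting the off-diagonal blocks of a real symmetric matrix does not increase
the sum of the absolute values of its eigenvalues. -/
theorem absRootSum_add_le_fromBlocks {m n : Type*} [Fintype m] [DecidableEq m] [Fintype n]
    [DecidableEq n] {A : Matrix m m ℝ} {B : Matrix m n ℝ} {D : Matrix n n ℝ}
    (hA : A.IsHermitian) (hD : D.IsHermitian) :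
    absRootSum A.charpoly + absRootSum D.charpoly
      ≤ absRootSum (fromBlocks A B Bᵀ D).charpoly := by
  have hM : (fromBlocks A B Bᵀ D).IsHermitian :=
    hA.fromBlocks (by ext; simp) hD
  set U : Matrix m m ℝ := (hA.eigenvectorUnitary).1 with hU
  set V : Matrix n n ℝ := (hD.eigenvectorUnitary).1 with hV
  have hUU : Uᵀ * U = 1 := by
    have := Unitary.coe_star_mul_self hA.eigenvectorUnitary
    simpa [star_eq_conjTranspose] using this
  have hVV : Vᵀ * V = 1 := by
    have := Unitary.coe_star_mul_self hD.eigenvectorUnitary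
    simpa [star_eq_conjTranspose] using this
  have hAd : Uᵀ * A * U = diagonal hA.eigenvalues := by
    have := hA.conjStarAlgAut_star_eigenvectorUnitary
    rw [Unitary.conjStarAlgAut_star_apply] at this
    simpa [star_eq_conjTranspose, Function.comp_def] using this
  have hDd : Vᵀ * D * V = diagonal hD.eigenvalues := by
    have := hD.conjStarAlgAut_star_eigenvectorUnitary
    rw [Unitary.conjStarAlgAut_star_apply] at this
    simpa [star_eq_conjTranspose, Function.comp_def] using this
  -- Conjugation by this block-diagonal orthogonal matrix diagonalizes both diagonal blocks at once,
  -- so the new diagonal lists the eigenvalues of `A` and `D`.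
  have key := sum_abs_diag_conj_le (W := fromBlocks U 0 0 V) hM (by
    simp [fromBlocks_transpose, fromBlocks_multiply, hUU, hVV])
  rw [← sum_abs_eigenvalues_eq hA, ← sum_abs_eigenvalues_eq hD]
  simpa [fromBlocks_transpose, fromBlocks_multiply, hAd, hDd] using key

/-! ### Binary trees and their adjacency matrices -/

/-- Binary trees, encoding rooted trees in which every vertex has at most two children. -/
inductive BinTree : Type
  | nil : BinTree
  | node : BinTree → BinTree → BinTree

namespace BinTree

/-- The number of nodes. -/
def size : BinTree → ℕ
  | nil => 0
  | node l r => 1 + l.size + r.size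

/-- The type of nodes of a binary tree. -/
def Vert : BinTree → Type
  | nil => Empty
  | node l r => Unit ⊕ (l.Vert ⊕ r.Vert)

instance instFintypeVert : (t : BinTree) → Fintype t.Vert
  | nil => inferInstanceAs (Fintype Empty)
  | node l r =>
    letI := instFintypeVert l
    letI := instFintypeVert r
    inferInstanceAs (Fintype (Unit ⊕ (l.Vert ⊕ r.Vert)))

instance instDecidableEqVert : (t : BinTree) → DecidableEq t.Vert
  | nil => inferInstanceAs (DecidableEq Empty)
  | node l r =>
    letI := instDecidableEqVert l
    letI := instDecidableEqVert r
    inferInstanceAs (DecidableEq (Unit ⊕ (l.Vert ⊕ r.Vert)))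

theorem card_vert (t : BinTree) : Fintype.card t.Vert = t.size := by
  induction t with
  | nil => rfl
  | node l r hl hr =>
    have : Fintype.card (node l r).Vert = Fintype.card (Unit ⊕ (l.Vert ⊕ r.Vert)) := rfl
    rw [this, Fintype.card_sum, Fintype.card_sum, hl, hr, size]
    simp [add_assoc]

/-- The predicate of being the root. -/
def IsRoot : (t : BinTree) → t.Vert → Prop
  | node _ _, .inl _ => True
  | node _ _, .inr _ => False

/-- Adjacency: each node is adjacent to the roots of its two subtrees. -/
def Adj : (t : BinTree) → t.Vert → t.Vert → Prop
  | node _ _, .inl _, .inl _ => False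
  | node l _, .inl _, .inr (.inl y) => l.IsRoot y
  | node _ r, .inl _, .inr (.inr y) => r.IsRoot y
  | node l _, .inr (.inl x), .inl _ => l.IsRoot x
  | node _ r, .inr (.inr x), .inl _ => r.IsRoot x
  | node l _, .inr (.inl x), .inr (.inl y) => l.Adj x y
  | node _ r, .inr (.inr x), .inr (.inr y) => r.Adj x y
  | node _ _, .inr (.inl _), .inr (.inr _) => False
  | node _ _, .inr (.inr _), .inr (.inl _) => False

theorem adj_symm {t : BinTree} {x y : t.Vert} (h : t.Adj x y) : t.Adj y x := by
  induction t with
  | nil => exact x.elim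
  | node l r hl hr =>
    rcases x with x | x | x <;> rcases y with y | y | y <;> simp only [Adj] at h ⊢ <;>
      first | exact h | exact hl h | exact hr h

theorem adj_irrefl {t : BinTree} (x : t.Vert) : ¬ t.Adj x x := by
  induction t with
  | nil => exact x.elim
  | node l r hl hr =>
    rcases x with x | x | x <;> simp only [Adj] <;> first | exact not_false | apply hl | apply hr

/-- The underlying graph of a binary tree. -/
def graph (t : BinTree) : SimpleGraph t.Vert where
  Adj := t.Adj
  symm := ⟨fun _ _ => adj_symm⟩
  loopless := ⟨adj_irrefl⟩

/-- The indicator of the root. -/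
noncomputable def rootVec : (t : BinTree) → t.Vert → ℝ
  | node _ _ => Sum.elim (fun _ => 1) (fun _ => 0)
  | nil => Empty.elim

/-- The adjacency matrix. -/
noncomputable def mat : (t : BinTree) → Matrix t.Vert t.Vert ℝ
  | nil => (0 : Matrix Empty Empty ℝ)
  | node l r => fromBlocks (0 : Matrix Unit Unit ℝ) (of fun _ => Sum.elim l.rootVec r.rootVec)
      (of fun y _ => Sum.elim l.rootVec r.rootVec y) (fromBlocks l.mat 0 0 r.mat)

theorem rootVec_of_isRoot {t : BinTree} {x : t.Vert} (h : t.IsRoot x) : t.rootVec x = 1 := by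
  cases t with
  | nil => exact x.elim
  | node l r => rcases x with x | x
                · rfl
                · exact h.elim

theorem rootVec_of_not_isRoot {t : BinTree} {x : t.Vert} (h : ¬ t.IsRoot x) :
    t.rootVec x = 0 := by
  cases t with
  | nil => exact x.elim
  | node l r => rcases x with x | x
                · exact (h trivial).elim
                · rfl

theorem mat_of_adj {t : BinTree} {x y : t.Vert} (h : t.Adj x y) : t.mat x y = 1 := by
  induction t with
  | nil => exact x.elim
  | node l r hl hr =>
    rcases x with x | x | x <;> rcases y with y | y | y
    exacts [h.elim, rootVec_of_isRoot (t := l) h, rootVec_of_isRoot (t := r) h,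
      rootVec_of_isRoot (t := l) h, hl h, h.elim, rootVec_of_isRoot (t := r) h, h.elim, hr h]

theorem mat_of_not_adj {t : BinTree} {x y : t.Vert} (h : ¬ t.Adj x y) : t.mat x y = 0 := by
  induction t with
  | nil => exact x.elim
  | node l r hl hr =>
    rcases x with x | x | x <;> rcases y with y | y | y
    exacts [rfl, rootVec_of_not_isRoot (t := l) h, rootVec_of_not_isRoot (t := r) h,
      rootVec_of_not_isRoot (t := l) h, hl h, rfl, rootVec_of_not_isRoot (t := r) h, rfl, hr h]

theorem isHermitian_mat (t : BinTree) : t.mat.IsHermitian := by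
  ext x y
  rw [conjTranspose_apply, star_trivial]
  by_cases h : t.Adj x y
  · rw [mat_of_adj h, mat_of_adj (adj_symm h)]
  · rw [mat_of_not_adj h, mat_of_not_adj fun h' => h (adj_symm h')]

/-- The sum of the absolute values of the eigenvalues. -/
noncomputable def en (t : BinTree) : ℝ := absRootSum t.mat.charpoly

theorem energy_graph (t : BinTree) [DecidableRel t.graph.Adj] : energy t.graph = t.en := by
  rw [energy_eq_absRootSum, en]
  congr 2
  ext x y
  rw [SimpleGraph.adjMatrix_apply]
  split_ifs with h
  · exact (mat_of_adj h).symm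
  · exact (mat_of_not_adj h).symm

/-! ### Cutting a tree at an edge -/

/-- The adjacency matrix of the graph obtained by joining the roots of two trees by an edge. -/
noncomputable def joinMat (s t : BinTree) : Matrix (s.Vert ⊕ t.Vert) (s.Vert ⊕ t.Vert) ℝ :=
  fromBlocks s.mat (of fun x y => s.rootVec x * t.rootVec y)
    (of fun x y => s.rootVec x * t.rootVec y)ᵀ t.mat

theorem en_add_le_joinMat (s t : BinTree) : s.en + t.en ≤ absRootSum (joinMat s t).charpoly :=
  absRootSum_add_le_fromBlocks s.isHermitian_mat t.isHermitian_mat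

theorem charpoly_joinMat_nil (t : BinTree) : (joinMat t nil).charpoly = t.mat.charpoly := by
  let e : t.Vert ⊕ nil.Vert ≃ t.Vert := Equiv.sumEmpty t.Vert Empty
  rw [← charpoly_reindex e]
  congr 1

/-- Both sides describe one tree: the marked edge moves from above the root of `node a b` to the
edge leading down to `a`, and the old root becomes the root of the remainder. -/
theorem charpoly_joinMat_left (a b c : BinTree) :
    (joinMat (node a b) c).charpoly = (joinMat a (node b c)).charpoly := by
  let e : (node a b).Vert ⊕ c.Vert ≃ a.Vert ⊕ (node b c).Vert :=
    { toFun := fun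
        | .inl (.inl u) => .inr (.inl u)
        | .inl (.inr (.inl x)) => .inl x
        | .inl (.inr (.inr x)) => .inr (.inr (.inl x))
        | .inr x => .inr (.inr (.inr x))
      invFun := fun
        | .inr (.inl u) => .inl (.inl u)
        | .inl x => .inl (.inr (.inl x))
        | .inr (.inr (.inl x)) => .inl (.inr (.inr x))
        | .inr (.inr (.inr x)) => .inr x
      left_inv := by rintro ((u | x | x) | x) <;> rfl
      right_inv := by rintro (x | u | x | x) <;> rfl }
  rw [← charpoly_reindex e]
  congr 1
  -- The off-diagonal blocks are products of root indicators; where a node's own root indicator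
  -- enters, it contributes a factor 1 or 0.
  ext (x | u | x | x) (y | v | y | y) <;>
    first
    | rfl
    | exact one_mul _
    | exact zero_mul _
    | exact (mul_one _).symm
    | exact (mul_zero (_ : ℝ)).symm
    | exact (zero_mul (_ : ℝ)).trans (mul_zero (_ : ℝ)).symm

theorem charpoly_joinMat_right (a b c : BinTree) :
    (joinMat (node a b) c).charpoly = (joinMat b (node a c)).charpoly := by
  let e : (node a b).Vert ⊕ c.Vert ≃ b.Vert ⊕ (node a c).Vert :=
    { toFun := fun
        | .inl (.inl u) => .inr (.inl u)
        | .inl (.inr (.inr x)) => .inl x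
        | .inl (.inr (.inl x)) => .inr (.inr (.inl x))
        | .inr x => .inr (.inr (.inr x))
      invFun := fun
        | .inr (.inl u) => .inl (.inl u)
        | .inl x => .inl (.inr (.inr x))
        | .inr (.inr (.inl x)) => .inl (.inr (.inl x))
        | .inr (.inr (.inr x)) => .inr x
      left_inv := by rintro ((u | x | x) | x) <;> rfl
      right_inv := by rintro (x | u | x | x) <;> rfl }
  rw [← charpoly_reindex e]
  congr 1
  ext (x | u | x | x) (y | v | y | y) <;>
    first
    | rfl
    | exact one_mul _
    | exact zero_mul _
    | exact (mul_one _).symm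
    | exact (mul_zero (_ : ℝ)).symm
    | exact (zero_mul (_ : ℝ)).trans (mul_zero (_ : ℝ)).symm

/-- `Split t s c` says that `t` arises, up to the choice of a root, by joining the roots of `s`
and `c`, where `s` is a subtree of `t` and `c` is the rest of `t`, rooted next to `s`. -/
inductive Split (t : BinTree) : BinTree → BinTree → Prop
  | refl : Split t t nil
  | left {a b c : BinTree} : Split t (node a b) c → Split t a (node b c)
  | right {a b c : BinTree} : Split t (node a b) c → Split t b (node a c)

theorem Split.charpoly_eq {t s c : BinTree} (h : Split t s c) :
    t.mat.charpoly = (joinMat s c).charpoly := by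
  induction h with
  | refl => rw [charpoly_joinMat_nil]
  | left _ ih => rw [ih, charpoly_joinMat_left]
  | right _ ih => rw [ih, charpoly_joinMat_right]

theorem Split.en_add_le {t s c : BinTree} (h : Split t s c) : s.en + c.en ≤ t.en := by
  rw [en, en, en, h.charpoly_eq]
  exact en_add_le_joinMat s c

theorem Split.size_eq {t s c : BinTree} (h : Split t s c) : t.size = s.size + c.size := by
  induction h with
  | refl => rfl
  | left _ ih => simp only [size] at ih ⊢; omega
  | right _ ih => simp only [size] at ih ⊢; omega

/-! ### Recursion for the characteristic polynomial -/

/-- The characteristic polynomials of a tree and of the forest left when its root is deleted,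
computed from the leaves up. -/
noncomputable def polys : BinTree → ℝ[X] × ℝ[X]
  -- The second entry is 0 by convention, so that an empty child drops out of the recursion.
  | nil => (1, 0)
  | node l r => (X * (l.polys.1 * r.polys.1) - l.polys.2 * r.polys.1 - l.polys.1 * r.polys.2,
      l.polys.1 * r.polys.1)

/-- The two subtracted products are each at most `a * b`, so for `x ≥ 3` at least one `a * b`
survives, which is the second polynomial of the node. Positivity justifies the divisions in
`det_sub_mat`. -/
theorem eval_polys_bounds (t : BinTree) {x : ℝ} (hx : 3 ≤ x) :
    0 < t.polys.1.eval x ∧ 0 ≤ t.polys.2.eval x ∧ t.polys.2.eval x ≤ t.polys.1.eval x := by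
  induction t with
  | nil => simp [polys]
  | node l r hl hr =>
    obtain ⟨hl1, hl2, hl3⟩ := hl
    obtain ⟨hr1, hr2, hr3⟩ := hr
    simp only [polys, eval_sub, eval_mul, eval_X]
    set a := l.polys.1.eval x
    set b := r.polys.1.eval x
    set c := l.polys.2.eval x
    set d := r.polys.2.eval x
    have hab : 0 < a * b := mul_pos hl1 hr1
    have h1 : c * b ≤ a * b := mul_le_mul_of_nonneg_right hl3 hr1.le
    have h2 : a * d ≤ a * b := mul_le_mul_of_nonneg_left hr3 hl1.le
    have h3 : 3 * (a * b) ≤ x * (a * b) := mul_le_mul_of_nonneg_right hx hab.le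
    refine ⟨by linarith, hab.le, by linarith⟩

/-- Bordering a matrix by a vector `ρ`: determinant and solution of a linear system. -/
theorem det_bordered {n : Type*} [Fintype n] [DecidableEq n] {M : Matrix n n ℝ} {ρ w : n → ℝ}
    {x : ℝ} (h : (scalar n x - M) *ᵥ w = ρ) :
    (scalar (Unit ⊕ n) x - fromBlocks (0 : Matrix Unit Unit ℝ) (of fun _ => ρ)
        (of fun y _ => ρ y) M).det = (x - ρ ⬝ᵥ w) * (scalar n x - M).det ∧
      (scalar (Unit ⊕ n) x - fromBlocks (0 : Matrix Unit Unit ℝ) (of fun _ => ρ)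
        (of fun y _ => ρ y) M) *ᵥ Sum.elim (fun _ => 1) w
        = Sum.elim (fun _ => x - ρ ⬝ᵥ w) 0 := by
  have hK : scalar (Unit ⊕ n) x - fromBlocks (0 : Matrix Unit Unit ℝ) (of fun _ => ρ)
      (of fun y _ => ρ y) M = fromBlocks (of fun _ _ => x : Matrix Unit Unit ℝ)
        (of fun _ => -ρ) (of fun y _ => -ρ y) (scalar n x - M) := by
    ext (i | i) (j | j) <;> simp [diagonal_apply]
  rw [hK]
  constructor
  -- A column operation of determinant one clears the lower left block; this is a Schur complement
  -- in which the solution `w` replaces an inverse matrix.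
  · have hmul : fromBlocks (of fun _ _ => x : Matrix Unit Unit ℝ)
        (of fun _ => -ρ) (of fun y _ => -ρ y) (scalar n x - M) *
        fromBlocks 1 0 (of fun y _ => w y) 1 =
        fromBlocks (of fun _ _ => x - ρ ⬝ᵥ w) (of fun _ => -ρ) 0 (scalar n x - M) := by
      rw [fromBlocks_multiply]
      congr 1
      · ext i j
        simp [Matrix.mul_apply, dotProduct, sub_eq_add_neg]
      · simp
      · ext i j
        have := congrFun h i
        rw [mulVec, dotProduct] at this
        simp only [Matrix.mul_one, Matrix.add_apply, of_apply, Matrix.mul_apply, this,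
          Matrix.zero_apply]
        ring
      · simp
    have := congrArg det hmul
    rw [det_mul, det_fromBlocks_zero₁₂, det_fromBlocks_zero₂₁] at this
    simpa using this
  · rw [fromBlocks_mulVec]
    congr 1
    · ext i
      simp [mulVec, dotProduct, sub_eq_add_neg]
    · rw [Sum.elim_comp_inr, h]
      ext i
      simp [mulVec, dotProduct]

/-- The vector `w` is the resolvent applied to the root indicator, and its value at the root is the
quotient of the two polynomials. Carrying this quotient along with the determinant is what closes
the induction. -/
theorem det_sub_mat (t : BinTree) {x : ℝ} (hx : 3 ≤ x) :
    (∃ w : t.Vert → ℝ, (scalar _ x - t.mat) *ᵥ w = t.rootVec ∧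
      t.rootVec ⬝ᵥ w = t.polys.2.eval x / t.polys.1.eval x) ∧
    (scalar _ x - t.mat).det = t.polys.1.eval x := by
  induction t with
  | nil =>
    refine ⟨⟨fun _ => 0, ?_, ?_⟩, ?_⟩
    · ext i; exact i.elim
    · simp [polys]
    · exact (det_isEmpty (n := Empty)).trans (by simp [polys])
  | node l r hl hr =>
    obtain ⟨⟨u, hu, hu'⟩, hdl⟩ := hl
    obtain ⟨⟨v, hv, hv'⟩, hdr⟩ := hr
    have hlp := (eval_polys_bounds l hx).1
    have hrp := (eval_polys_bounds r hx).1
    have hp := (eval_polys_bounds (node l r) hx).1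
    have hsc : scalar (l.Vert ⊕ r.Vert) x - fromBlocks l.mat 0 0 r.mat =
        fromBlocks (scalar _ x - l.mat) 0 0 (scalar _ x - r.mat) := by
      ext (i | i) (j | j) <;> simp [diagonal_apply]
    have hw : (scalar (l.Vert ⊕ r.Vert) x - fromBlocks l.mat 0 0 r.mat) *ᵥ Sum.elim u v =
        Sum.elim l.rootVec r.rootVec := by
      rw [hsc, fromBlocks_mulVec, Sum.elim_comp_inl, Sum.elim_comp_inr, hu, hv, zero_mulVec,
        zero_mulVec, add_zero, zero_add]
    obtain ⟨h1, h2⟩ := det_bordered hw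
    set g := x - Sum.elim l.rootVec r.rootVec ⬝ᵥ Sum.elim u v with hg
    have hgval : g * (l.polys.1.eval x * r.polys.1.eval x) = (node l r).polys.1.eval x := by
      rw [hg, sumElim_dotProduct_sumElim, hu', hv']
      simp only [polys, eval_sub, eval_mul, eval_X]
      field_simp
      ring
    have hlr : 0 < l.polys.1.eval x * r.polys.1.eval x := mul_pos hlp hrp
    have hg0 : g ≠ 0 := by
      rintro h0
      rw [h0, zero_mul] at hgval
      exact hp.ne hgval
    -- The vector with 1 at the root and `u`, `v` below is sent to `g` times the root indicator, so
    -- dividing by `g` solves the system for the node.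
    refine ⟨⟨g⁻¹ • (Sum.elim (fun _ => 1) (Sum.elim u v) : Unit ⊕ (l.Vert ⊕ r.Vert) → ℝ),
      ?_, ?_⟩, ?_⟩
    · refine (mulVec_smul _ _ _).trans ((congrArg (g⁻¹ • ·) h2).trans ?_)
      ext (i | i)
      · exact inv_mul_cancel₀ hg0
      · exact mul_zero _
    · refine (dotProduct_smul _ _ _).trans ?_
      have : (node l r).rootVec ⬝ᵥ (Sum.elim (fun _ => 1) (Sum.elim u v)
          : Unit ⊕ (l.Vert ⊕ r.Vert) → ℝ) = 1 :=
        (sumElim_dotProduct_sumElim (fun _ : Unit => (1 : ℝ)) (fun _ => 1) (fun _ => 0)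
          (Sum.elim u v)).trans (by simp [dotProduct])
      refine (congrArg (g⁻¹ • ·) this).trans ?_
      rw [← hgval, smul_eq_mul, mul_one, polys, eval_mul]
      field_simp
    · refine h1.trans ?_
      rw [hsc, det_fromBlocks_zero₂₁, hdl, hdr, hgval]

/-- Two polynomials that agree on `[3, ∞)` are equal. -/
theorem charpoly_mat (t : BinTree) : t.mat.charpoly = t.polys.1 := by
  refine Polynomial.eq_of_infinite_eval_eq _ _ ((Set.Ici_infinite (3 : ℝ)).mono fun x hx => ?_)
  rw [Set.mem_ofPred_eq, eval_charpoly]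
  exact (det_sub_mat t hx).2

/-- The characteristic polynomial of the tree obtained by joining two roots by an edge. -/
noncomputable def joinPoly (s c : BinTree) : ℝ[X] :=
  s.polys.1 * c.polys.1 - s.polys.2 * c.polys.2

/-- This is the bridge formula for characteristic polynomials. Moving the bridge down one level
preserves `joinPoly`, by the recursion defining `polys`. -/
theorem Split.polys_eq {t s c : BinTree} (h : Split t s c) : t.polys.1 = joinPoly s c := by
  induction h with
  | refl => simp [joinPoly, polys]
  | left _ ih => rw [ih, joinPoly, joinPoly, polys, polys]; ring
  | right _ ih => rw [ih, joinPoly, joinPoly, polys, polys]; ring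

theorem en_eq (t : BinTree) : t.en = absRootSum t.polys.1 := by rw [en, charpoly_mat]

theorem Split.en_eq {t s c : BinTree} (h : Split t s c) : t.en = absRootSum (joinPoly s c) := by
  rw [BinTree.en_eq, h.polys_eq]

end BinTree

/-! ### Lower bounds for sums of absolute values of roots -/

theorem absRootSum_mul {p q : ℝ[X]} (hp : p ≠ 0) (hq : q ≠ 0) :
    absRootSum (p * q) = absRootSum p + absRootSum q := by
  simp [absRootSum, roots_mul (mul_ne_zero hp hq)]

theorem absRootSum_one : absRootSum 1 = 0 := by simp [absRootSum]

theorem absRootSum_pow (p : ℝ[X]) (k : ℕ) : absRootSum (p ^ k) = k * absRootSum p := by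
  simp [absRootSum, Multiset.map_nsmul, Multiset.sum_nsmul]

theorem absRootSum_X : absRootSum X = 0 := by simp [absRootSum]

theorem X_sq_sub_C_ne_zero (a : ℝ) : (X ^ 2 - C a : ℝ[X]) ≠ 0 :=
  X_pow_sub_C_ne_zero two_pos a

theorem absRootSum_X_sq_sub_C {a : ℝ} (ha : 0 ≤ a) : absRootSum (X ^ 2 - C a) = 2 * √a := by
  have h : (X ^ 2 - C a : ℝ[X]) = (X - C (√a)) * (X - C (-√a)) := by
    have : C a = (C (√a) : ℝ[X]) ^ 2 := by rw [← C_pow, Real.sq_sqrt ha]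
    rw [this, C_neg]
    ring
  rw [h, absRootSum_mul (X_sub_C_ne_zero _) (X_sub_C_ne_zero _)]
  simp [absRootSum, abs_of_nonneg (Real.sqrt_nonneg a)]
  ring

theorem sum_abs_le_absRootSum {p : ℝ[X]} (hp : p ≠ 0) {S : Finset ℝ} (hS : ∀ r ∈ S, p.IsRoot r) :
    ∑ r ∈ S, |r| ≤ absRootSum p := by
  have hle : S.val ≤ p.roots := (Multiset.le_iff_subset S.nodup).2 fun r hr =>
    (mem_roots hp).2 (hS r hr)
  obtain ⟨T, hT⟩ := Multiset.le_iff_exists_add.1 hle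
  rw [absRootSum, hT, Multiset.map_add, Multiset.sum_add]
  have : 0 ≤ (T.map abs).sum := Multiset.sum_nonneg fun x hx => by
    obtain ⟨y, -, rfl⟩ := Multiset.mem_map.1 hx
    exact abs_nonneg y
  exact le_add_of_nonneg_right this

/-- Sign changes of an even polynomial at positive points bound the sum of the absolute values of
its roots from below. -/
theorem two_mul_sum_le_absRootSum {p : ℝ[X]} (heven : ∀ x, p.eval (-x) = p.eval x) (hp : p ≠ 0)
    {k : ℕ} (q : Fin (k + 1) → ℝ) (h0 : 0 < q 0)
    (hq : ∀ i : Fin k, q i.castSucc < q i.succ ∧ p.eval (q i.castSucc) * p.eval (q i.succ) < 0) :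
    2 * ∑ i : Fin k, q i.castSucc ≤ absRootSum p := by
  have hmono : StrictMono q := Fin.strictMono_iff_lt_succ.2 fun i => (hq i).1
  have hpos : ∀ i, 0 < q i := fun i => h0.trans_le (hmono.monotone (Fin.zero_le i))
  have hroot : ∀ i : Fin k, ∃ r, q i.castSucc < r ∧ r < q i.succ ∧ p.IsRoot r := fun i => by
    obtain ⟨hlt, hneg⟩ := hq i
    have hcont : ContinuousOn (fun x => p.eval x) (Set.Icc (q i.castSucc) (q i.succ)) :=
      p.continuous.continuousOn
    rcases mul_neg_iff.1 hneg with ⟨h1, h2⟩ | ⟨h1, h2⟩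
    · obtain ⟨r, hr, hr0⟩ := intermediate_value_Ioo' hlt.le hcont ⟨h2, h1⟩
      exact ⟨r, hr.1, hr.2, hr0⟩
    · obtain ⟨r, hr, hr0⟩ := intermediate_value_Ioo hlt.le hcont ⟨h1, h2⟩
      exact ⟨r, hr.1, hr.2, hr0⟩
  choose r hr1 hr2 hr3 using hroot
  have hrpos : ∀ i, 0 < r i := fun i => (hpos _).trans (hr1 i)
  have hrmono : StrictMono r := fun i j hij => by
    refine (hr2 i).trans (lt_of_le_of_lt (hmono.monotone ?_) (hr1 j))
    rw [Fin.le_def, Fin.val_succ, Fin.val_castSucc]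
    exact hij
  have hdisj : Disjoint (Finset.univ.image r) (Finset.univ.image fun i => -r i) := by
    rw [Finset.disjoint_left]
    intro x hx hx'
    obtain ⟨i, -, rfl⟩ := Finset.mem_image.1 hx
    obtain ⟨j, -, hj⟩ := Finset.mem_image.1 hx'
    have h1 := hrpos i
    have h2 := hrpos j
    linarith
  -- By evenness, each root found between two sample points comes with its negative, whence the
  -- factor 2.
  have key := sum_abs_le_absRootSum hp
    (S := Finset.univ.image r ∪ Finset.univ.image fun i => -r i) (by
      intro x hx
      rcases Finset.mem_union.1 hx with hx | hx <;> obtain ⟨i, -, rfl⟩ := Finset.mem_image.1 hx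
      · exact hr3 i
      · exact (heven _).trans (hr3 i))
  rw [Finset.sum_union hdisj, Finset.sum_image hrmono.injective.injOn,
    Finset.sum_image fun i _ j _ hij => hrmono.injective (neg_injective hij)] at key
  simp only [abs_neg, abs_of_pos (hrpos _)] at key
  -- Each root exceeds the left end of its interval; the last sample point only closes the last
  -- interval.
  have : ∑ i : Fin k, q i.castSucc ≤ ∑ i, r i := Finset.sum_le_sum fun i _ => (hr1 i).le
  linarith

/-- The sum of the absolute values of the roots of a polynomial with known factors. -/
theorem absRootSum_of_eq_mul {p h : ℝ[X]} (z a b c d : ℕ)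
    (hp : p = X ^ z * ((X ^ 2 - 1) ^ a * (X ^ 2 - 2) ^ b * (X ^ 2 - 3) ^ c * (X ^ 2 - 4) ^ d * h))
    (hh : h ≠ 0) :
    absRootSum p = 2 * a + b * (2 * √2) + c * (2 * √3) + 4 * d + absRootSum h := by
  have e1 : (X ^ 2 - 1 : ℝ[X]) = X ^ 2 - C 1 := by rw [C_1]
  have e2 : (X ^ 2 - 2 : ℝ[X]) = X ^ 2 - C 2 := by rw [map_ofNat C 2]
  have e3 : (X ^ 2 - 3 : ℝ[X]) = X ^ 2 - C 3 := by rw [map_ofNat C 3]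
  have e4 : (X ^ 2 - 4 : ℝ[X]) = X ^ 2 - C 4 := by rw [map_ofNat C 4]
  have n0 : (X : ℝ[X]) ^ z ≠ 0 := pow_ne_zero _ X_ne_zero
  have n1 : (X ^ 2 - C 1 : ℝ[X]) ^ a ≠ 0 := pow_ne_zero _ (X_sq_sub_C_ne_zero 1)
  have n2 : (X ^ 2 - C 2 : ℝ[X]) ^ b ≠ 0 := pow_ne_zero _ (X_sq_sub_C_ne_zero 2)
  have n3 : (X ^ 2 - C 3 : ℝ[X]) ^ c ≠ 0 := pow_ne_zero _ (X_sq_sub_C_ne_zero 3)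
  have n4 : (X ^ 2 - C 4 : ℝ[X]) ^ d ≠ 0 := pow_ne_zero _ (X_sq_sub_C_ne_zero 4)
  have n12 := mul_ne_zero n1 n2
  have n123 := mul_ne_zero n12 n3
  have n1234 := mul_ne_zero n123 n4
  have s4 : √4 = (2 : ℝ) := by rw [show (4 : ℝ) = 2 ^ 2 by norm_num]; exact Real.sqrt_sq two_pos.le
  rw [hp, e1, e2, e3, e4, absRootSum_mul n0 (mul_ne_zero n1234 hh), absRootSum_mul n1234 hh,
    absRootSum_mul n123 n4, absRootSum_mul n12 n3, absRootSum_mul n1 n2]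
  simp only [absRootSum_pow, absRootSum_X]
  rw [absRootSum_X_sq_sub_C zero_le_one, absRootSum_X_sq_sub_C zero_le_two,
    absRootSum_X_sq_sub_C zero_le_three, absRootSum_X_sq_sub_C zero_le_four, Real.sqrt_one, s4]
  ring

/-- A lower bound for the sum of the absolute values of the roots of a polynomial with known
factors, using sign changes of the remaining even factor. -/
theorem le_absRootSum_of_eq_mul {p h : ℝ[X]} (z a b c d : ℕ)
    (hp : p = X ^ z * ((X ^ 2 - 1) ^ a * (X ^ 2 - 2) ^ b * (X ^ 2 - 3) ^ c * (X ^ 2 - 4) ^ d * h))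
    (heven : ∀ x, h.eval (-x) = h.eval x) (h0 : h.eval 0 ≠ 0)
    {k : ℕ} (q : Fin (k + 1) → ℝ) (hq0 : 0 < q 0)
    (hq : ∀ i : Fin k, q i.castSucc < q i.succ ∧ h.eval (q i.castSucc) * h.eval (q i.succ) < 0) :
    2 * a + b * 2.828 + c * 3.464 + 4 * d + 2 * ∑ i : Fin k, q i.castSucc ≤ absRootSum p := by
  have hh : h ≠ 0 := by rintro rfl; simp at h0
  rw [absRootSum_of_eq_mul z a b c d hp hh]
  -- The constants 2.828 and 3.464 of the statement are twice these bounds.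
  have s2 : (1.414 : ℝ) ≤ √2 := Real.le_sqrt_of_sq_le (by norm_num)
  have s3 : (1.732 : ℝ) ≤ √3 := Real.le_sqrt_of_sq_le (by norm_num)
  have key := two_mul_sum_le_absRootSum heven hh q hq0 hq
  have hb : (b : ℝ) * 2.828 ≤ b * (2 * √2) := by gcongr; linarith
  have hc : (c : ℝ) * 3.464 ≤ c * (2 * √3) := by gcongr; linarith
  linarith

namespace BinTree

/-! ### Energies of the small trees -/

/-- The one-vertex tree. -/
abbrev leaf : BinTree := node nil nil

/-- The path on two vertices. -/
abbrev edge : BinTree := node leaf nil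

/-- The path on three vertices, rooted at its centre. -/
abbrev cherry : BinTree := node leaf leaf

/-- The path on three vertices, rooted at an end. -/
abbrev path : BinTree := node edge nil

/-- The star on four vertices, rooted at a leaf. -/
abbrev cherryStem : BinTree := node cherry nil

/-- The tree on seven vertices with two cherries, rooted at its centre. -/
abbrev doubleCherry : BinTree := node cherry cherry

/-- The tree on seven vertices with two cherries, rooted at a leaf. -/
abbrev leafDoubleCherry : BinTree := node (node leaf cherryStem) nil

/-- The graph `Q`, rooted at a leaf. -/
abbrev leafQ : BinTree := node (node leaf cherry) nil

/-- The pattern of all the numerical bounds: the five numbers are the exponents of `X`, `X² - 1`,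
`X² - 2`, `X² - 3`, `X² - 4`, and `h` is the remaining factor. The sample points lie just below the
positive roots of `h`, except the last, 3, which lies above them all. -/
theorem en_leaf_cherry : 5.2 ≤ (node leaf cherry).en := by
  rw [en_eq]
  refine le_trans ?_ (le_absRootSum_of_eq_mul (h := X ^ 4 - 4 * X ^ 2 + 2) 1 0 0 0 0 ?_ ?_ ?_
    ![0.76, 1.84, 3] ?_ ?_)
  · norm_num [Fin.sum_univ_succ]
  · simp only [polys]
    ring
  · intro x
    simp only [eval_add, eval_sub, eval_mul, eval_pow, eval_X, eval_ofNat]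
    ring
  · norm_num
  · norm_num
  · norm_num [Fin.forall_fin_succ]

theorem en_double_nil : 8.4 ≤ (node doubleCherry nil).en := by
  rw [en_eq]
  refine le_trans ?_ (le_absRootSum_of_eq_mul (h := X ^ 4 - 5 * X ^ 2 + 2) 2 0 1 0 0 ?_ ?_ ?_
    ![0.66, 2.13, 3] ?_ ?_)
  · norm_num [Fin.sum_univ_succ]
  · simp only [polys]
    ring
  · intro x
    simp only [eval_add, eval_sub, eval_mul, eval_pow, eval_X, eval_ofNat]
    ring
  · norm_num
  · norm_num
  · norm_num [Fin.forall_fin_succ]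

theorem en_leaf_stem : 6.14 ≤ (node leaf cherryStem).en := by
  rw [en_eq]
  refine le_trans ?_ (le_absRootSum_of_eq_mul (h := X ^ 4 - 5 * X ^ 2 + 5) 2 0 0 0 0 ?_ ?_ ?_
    ![1.17, 1.9, 3] ?_ ?_)
  · norm_num [Fin.sum_univ_succ]
  · simp only [polys]
    ring
  · intro x
    simp only [eval_add, eval_sub, eval_mul, eval_pow, eval_X, eval_ofNat]
    ring
  · norm_num
  · norm_num
  · norm_num [Fin.forall_fin_succ]

theorem en_leaf_double : 9.4 ≤ (node leaf doubleCherry).en := by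
  rw [en_eq]
  refine le_trans ?_ (le_absRootSum_of_eq_mul (h := X ^ 4 - 6 * X ^ 2 + 6) 3 0 1 0 0 ?_ ?_ ?_
    ![1.12, 2.17, 3] ?_ ?_)
  · norm_num [Fin.sum_univ_succ]
  · simp only [polys]
    ring
  · intro x
    simp only [eval_add, eval_sub, eval_mul, eval_pow, eval_X, eval_ofNat]
    ring
  · norm_num
  · norm_num
  · norm_num [Fin.forall_fin_succ]

theorem en_cherry_stem : 8.44 ≤ (node cherry cherryStem).en := by
  rw [en_eq]
  refine le_trans ?_ (le_absRootSum_of_eq_mul (h := X ^ 4 - 3 * X ^ 2 + 1) 2 0 0 0 1 ?_ ?_ ?_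
    ![0.61, 1.61, 3] ?_ ?_)
  · norm_num [Fin.sum_univ_succ]
  · simp only [polys]
    ring
  · intro x
    simp only [eval_add, eval_sub, eval_mul, eval_pow, eval_X, eval_ofNat, eval_one]
    ring
  · norm_num
  · norm_num
  · norm_num [Fin.forall_fin_succ]

theorem en_cherry_double : 11.64 ≤ (node cherry doubleCherry).en := by
  rw [en_eq]
  refine le_trans ?_ (le_absRootSum_of_eq_mul (h := X ^ 6 - 8 * X ^ 4 + 16 * X ^ 2 - 4) 3 0 1 0 0 ?_ ?_ ?_
    ![0.53, 1.67, 2.21, 3] ?_ ?_)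
  · norm_num [Fin.sum_univ_succ]
  · simp only [polys]
    ring
  · intro x
    simp only [eval_add, eval_sub, eval_mul, eval_pow, eval_X, eval_ofNat]
    ring
  · norm_num
  · norm_num
  · norm_num [Fin.forall_fin_succ]

theorem en_stem_stem : 9.46 ≤ (node cherryStem cherryStem).en := by
  rw [en_eq]
  -- The polynomial factors completely, so `h = 1`; a single sample point yields no interval and an
  -- empty sum.
  refine le_trans ?_ (le_absRootSum_of_eq_mul (h := 1) 3 1 0 1 1 ?_ ?_ ?_
    ![3] ?_ ?_)
  · norm_num [Fin.sum_univ_succ]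
  · simp only [polys]
    ring
  · simp
  · norm_num
  · norm_num
  · norm_num [Fin.forall_fin_succ]

theorem en_stem_double : 12.7 ≤ (node cherryStem doubleCherry).en := by
  rw [en_eq]
  refine le_trans ?_ (le_absRootSum_of_eq_mul (h := X ^ 6 - 9 * X ^ 4 + 23 * X ^ 2 - 14) 4 0 1 0 0 ?_ ?_ ?_
    ![0.94, 1.8, 2.2, 3] ?_ ?_)
  · norm_num [Fin.sum_univ_succ]
  · simp only [polys]
    ring
  · intro x
    simp only [eval_add, eval_sub, eval_mul, eval_pow, eval_X, eval_ofNat]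
    ring
  · norm_num
  · norm_num
  · norm_num [Fin.forall_fin_succ]

theorem en_double_double : 15.95 ≤ (node doubleCherry doubleCherry).en := by
  rw [en_eq]
  refine le_trans ?_ (le_absRootSum_of_eq_mul (h := X ^ 4 - 6 * X ^ 2 + 4) 5 0 2 0 1 ?_ ?_ ?_
    ![0.87, 2.28, 3] ?_ ?_)
  · norm_num [Fin.sum_univ_succ]
  · simp only [polys]
    ring
  · intro x
    simp only [eval_add, eval_sub, eval_mul, eval_pow, eval_X, eval_ofNat]
    ring
  · norm_num
  · norm_num
  · norm_num [Fin.forall_fin_succ]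

theorem en_stem_nil : 5.2 ≤ (node cherryStem nil).en := by
  rw [en_eq]
  refine le_trans ?_ (le_absRootSum_of_eq_mul (h := X ^ 4 - 4 * X ^ 2 + 2) 1 0 0 0 0 ?_ ?_ ?_
    ![0.76, 1.84, 3] ?_ ?_)
  · norm_num [Fin.sum_univ_succ]
  · simp only [polys]
    ring
  · intro x
    simp only [eval_add, eval_sub, eval_mul, eval_pow, eval_X, eval_ofNat]
    ring
  · norm_num
  · norm_num
  · norm_num [Fin.forall_fin_succ]

theorem join_leaf_cherry_stem : 9.2 ≤ absRootSum (joinPoly (node leaf cherry) cherryStem) := by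
  refine le_trans ?_ (le_absRootSum_of_eq_mul (h := X ^ 6 - 8 * X ^ 4 + 18 * X ^ 2 - 10) 3 0 0 0 0 ?_ ?_ ?_
    ![0.9, 1.6, 2.1, 3] ?_ ?_)
  · norm_num [Fin.sum_univ_succ]
  · simp only [joinPoly, polys]
    ring
  · intro x
    simp only [eval_add, eval_sub, eval_mul, eval_pow, eval_X, eval_ofNat]
    ring
  · norm_num
  · norm_num
  · norm_num [Fin.forall_fin_succ]

theorem join_leaf_stem_stem : 10.06 ≤ absRootSum (joinPoly (node leaf cherryStem) cherryStem) := by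
  refine le_trans ?_ (le_absRootSum_of_eq_mul (h := X ^ 4 - 6 * X ^ 2 + 7) 4 0 0 1 0 ?_ ?_ ?_
    ![1.2, 2.1, 3] ?_ ?_)
  · norm_num [Fin.sum_univ_succ]
  · simp only [joinPoly, polys]
    ring
  · intro x
    simp only [eval_add, eval_sub, eval_mul, eval_pow, eval_X, eval_ofNat]
    ring
  · norm_num
  · norm_num
  · norm_num [Fin.forall_fin_succ]

theorem join_leaf_stem_double : 13.22 ≤ absRootSum (joinPoly (node leaf cherryStem) doubleCherry) := by
  refine le_trans ?_ (le_absRootSum_of_eq_mul (h := X ^ 6 - 10 * X ^ 4 + 30 * X ^ 2 - 26) 5 0 1 0 0 ?_ ?_ ?_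
    ![1.2, 1.8, 2.2, 3] ?_ ?_)
  · norm_num [Fin.sum_univ_succ]
  · simp only [joinPoly, polys]
    ring
  · intro x
    simp only [eval_add, eval_sub, eval_mul, eval_pow, eval_X, eval_ofNat]
    ring
  · norm_num
  · norm_num
  · norm_num [Fin.forall_fin_succ]

theorem join_leaf_leaf_double : 10.05 ≤ absRootSum (joinPoly (node leaf leaf) doubleCherry) := by
  refine le_trans ?_ (le_absRootSum_of_eq_mul (h := X ^ 2 - 5) 4 0 2 0 0 ?_ ?_ ?_
    ![2.2, 3] ?_ ?_)
  · norm_num [Fin.sum_univ_succ]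
  · simp only [joinPoly, polys]
    ring
  · intro x
    simp only [eval_sub, eval_pow, eval_X, eval_ofNat]
    ring
  · norm_num
  · norm_num
  · norm_num [Fin.forall_fin_succ]

theorem join_cherry_stem_stem : 12.26 ≤ absRootSum (joinPoly (node cherry cherryStem) cherryStem) := by
  refine le_trans ?_ (le_absRootSum_of_eq_mul (h := X ^ 6 - 8 * X ^ 4 + 17 * X ^ 2 - 8) 4 0 0 1 0 ?_ ?_ ?_
    ![0.8, 1.5, 2.1, 3] ?_ ?_)
  · norm_num [Fin.sum_univ_succ]
  · simp only [joinPoly, polys]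
    ring
  · intro x
    simp only [eval_add, eval_sub, eval_mul, eval_pow, eval_X, eval_ofNat]
    ring
  · norm_num
  · norm_num
  · norm_num [Fin.forall_fin_succ]

theorem join_leaf_cherry_double : 12.29 ≤ absRootSum (joinPoly (node leaf cherry) doubleCherry) := by
  refine le_trans ?_ (le_absRootSum_of_eq_mul (h := X ^ 4 - 6 * X ^ 2 + 4) 4 0 1 1 0 ?_ ?_ ?_
    ![0.8, 2.2, 3] ?_ ?_)
  · norm_num [Fin.sum_univ_succ]
  · simp only [joinPoly, polys]
    ring
  · intro x
    simp only [eval_add, eval_sub, eval_mul, eval_pow, eval_X, eval_ofNat]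
    ring
  · norm_num
  · norm_num
  · norm_num [Fin.forall_fin_succ]

theorem join_stem_stem_stem : 13.32 ≤ absRootSum (joinPoly (node cherryStem cherryStem) cherryStem) := by
  refine le_trans ?_ (le_absRootSum_of_eq_mul (h := X ^ 4 - 6 * X ^ 2 + 6) 5 0 0 2 0 ?_ ?_ ?_
    ![1.1, 2.1, 3] ?_ ?_)
  · norm_num [Fin.sum_univ_succ]
  · simp only [joinPoly, polys]
    ring
  · intro x
    simp only [eval_add, eval_sub, eval_mul, eval_pow, eval_X, eval_ofNat]
    ring
  · norm_num
  · norm_num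
  · norm_num [Fin.forall_fin_succ]

theorem join_leaf_double_double : 16.45 ≤ absRootSum (joinPoly (node leaf doubleCherry) doubleCherry) := by
  refine le_trans ?_ (le_absRootSum_of_eq_mul (h := X ^ 4 - 7 * X ^ 2 + 8) 6 0 2 0 1 ?_ ?_ ?_
    ![1.1, 2.3, 3] ?_ ?_)
  · norm_num [Fin.sum_univ_succ]
  · simp only [joinPoly, polys]
    ring
  · intro x
    simp only [eval_add, eval_sub, eval_mul, eval_pow, eval_X, eval_ofNat]
    ring
  · norm_num
  · norm_num
  · norm_num [Fin.forall_fin_succ]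

theorem join_edge_path : 5.46 ≤ absRootSum (joinPoly edge path) := by
  refine le_trans ?_ (le_absRootSum_of_eq_mul (h := 1) 1 1 0 1 0 ?_ ?_ ?_
    ![3] ?_ ?_)
  · norm_num [Fin.sum_univ_succ]
  · simp only [joinPoly, polys]
    ring
  · simp
  · norm_num
  · norm_num
  · norm_num [Fin.forall_fin_succ]

theorem join_edge_leafDouble : 9.48 ≤ absRootSum (joinPoly edge leafDoubleCherry) := by
  refine le_trans ?_ (le_absRootSum_of_eq_mul (h := X ^ 6 - 8 * X ^ 4 + 19 * X ^ 2 - 13) 3 0 0 0 0 ?_ ?_ ?_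
    ![1.09, 1.59, 2.06, 3] ?_ ?_)
  · norm_num [Fin.sum_univ_succ]
  · simp only [joinPoly, polys]
    ring
  · intro x
    simp only [eval_add, eval_sub, eval_mul, eval_pow, eval_X, eval_ofNat]
    ring
  · norm_num
  · norm_num
  · norm_num [Fin.forall_fin_succ]

theorem join_leafStem_leafDouble : 13.2 ≤ absRootSum (joinPoly (node leaf cherryStem) leafDoubleCherry) := by
  refine le_trans ?_ (le_absRootSum_of_eq_mul (h := X ^ 8 - 12 * X ^ 6 + 51 * X ^ 4 - 90 * X ^ 2 + 55) 5 0 0 0 0 ?_ ?_ ?_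
    ![1.1, 1.5, 1.9, 2.1, 3] ?_ ?_)
  · norm_num [Fin.sum_univ_succ]
  · simp only [joinPoly, polys]
    ring
  · intro x
    simp only [eval_add, eval_sub, eval_mul, eval_pow, eval_X, eval_ofNat]
    ring
  · norm_num
  · norm_num
  · norm_num [Fin.forall_fin_succ]

theorem join_edge_edge : 4.4 ≤ absRootSum (joinPoly edge edge) := by
  refine le_trans ?_ (le_absRootSum_of_eq_mul (h := X ^ 4 - 3 * X ^ 2 + 1) 0 0 0 0 0 ?_ ?_ ?_
    ![0.6, 1.6, 3] ?_ ?_)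
  · norm_num [Fin.sum_univ_succ]
  · simp only [joinPoly, polys]
    ring
  · intro x
    simp only [eval_add, eval_sub, eval_mul, eval_pow, eval_X, eval_ofNat, eval_one]
    ring
  · norm_num
  · norm_num
  · norm_num [Fin.forall_fin_succ]

theorem join_edge_leafQ : 8.42 ≤ absRootSum (joinPoly edge leafQ) := by
  refine le_trans ?_ (le_absRootSum_of_eq_mul (h := X ^ 4 - 5 * X ^ 2 + 3) 2 0 1 0 0 ?_ ?_ ?_
    ![0.8, 2, 3] ?_ ?_)
  · norm_num [Fin.sum_univ_succ]
  · simp only [joinPoly, polys]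
    ring
  · intro x
    simp only [eval_add, eval_sub, eval_mul, eval_pow, eval_X, eval_ofNat]
    ring
  · norm_num
  · norm_num
  · norm_num [Fin.forall_fin_succ]

theorem sqrt_two_bounds : (1.414 : ℝ) ≤ √2 ∧ √2 ≤ 1.415 :=
  ⟨Real.le_sqrt_of_sq_le (by norm_num), Real.sqrt_le_iff.2 (by norm_num)⟩

theorem sqrt_three_bounds : (1.732 : ℝ) ≤ √3 ∧ √3 ≤ 1.733 :=
  ⟨Real.le_sqrt_of_sq_le (by norm_num), Real.sqrt_le_iff.2 (by norm_num)⟩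

theorem en_leaf : leaf.en = 0 := by
  rw [en_eq, absRootSum_of_eq_mul (h := 1) 1 0 0 0 0 (by simp [polys]) one_ne_zero]
  simp [absRootSum_one]

theorem en_edge : edge.en = 2 := by
  rw [en_eq, absRootSum_of_eq_mul (h := 1) 0 1 0 0 0 (by simp only [polys]; ring) one_ne_zero]
  simp [absRootSum_one]

theorem en_cherry : cherry.en = 2 * √2 := by
  rw [en_eq, absRootSum_of_eq_mul (h := 1) 1 0 1 0 0 (by simp only [polys]; ring) one_ne_zero]
  simp [absRootSum_one]

theorem en_path : path.en = 2 * √2 := by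
  rw [en_eq, absRootSum_of_eq_mul (h := 1) 1 0 1 0 0 (by simp only [polys]; ring) one_ne_zero]
  simp [absRootSum_one]

theorem en_cherryStem : cherryStem.en = 2 * √3 := by
  rw [en_eq, absRootSum_of_eq_mul (h := 1) 2 0 0 1 0 (by simp only [polys]; ring) one_ne_zero]
  simp [absRootSum_one]

theorem en_doubleCherry : doubleCherry.en = 4 + 2 * √2 := by
  rw [en_eq, absRootSum_of_eq_mul (h := 1) 3 0 1 0 1 (by simp only [polys]; ring) one_ne_zero]
  simp [absRootSum_one]
  ring

theorem en_leafDoubleCherry : leafDoubleCherry.en = 4 + 2 * √2 := by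
  rw [en_eq, absRootSum_of_eq_mul (h := 1) 3 0 1 0 1 (by simp only [polys]; ring) one_ne_zero]
  simp [absRootSum_one]
  ring

theorem en_leafQ : leafQ.en = 6 := by
  rw [en_eq, absRootSum_of_eq_mul (h := 1) 2 1 0 0 1 (by simp only [polys]; ring) one_ne_zero]
  simp [absRootSum_one]
  norm_num

/-! ### Exchanging children -/

/-- Equality of binary trees up to exchanging the two children of nodes. -/
inductive SwapEquiv : BinTree → BinTree → Prop
  | nil : SwapEquiv nil nil
  | congr {a a' b b' : BinTree} : SwapEquiv a a' → SwapEquiv b b' → SwapEquiv (node a b) (node a' b')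
  | swap {a a' b b' : BinTree} : SwapEquiv a a' → SwapEquiv b b' → SwapEquiv (node a b) (node b' a')

theorem SwapEquiv.polys_eq {s t : BinTree} (h : SwapEquiv s t) : s.polys = t.polys := by
  induction h with
  | nil => rfl
  | congr _ _ h1 h2 => rw [polys, polys, h1, h2]
  | swap _ _ h1 h2 => rw [polys, polys, h1, h2]; ext1 <;> ring

theorem SwapEquiv.size_eq {s t : BinTree} (h : SwapEquiv s t) : s.size = t.size := by
  induction h with
  | nil => rfl
  | congr _ _ h1 h2 => rw [size, size, h1, h2]
  | swap _ _ h1 h2 => rw [size, size, h1, h2]; ring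

theorem SwapEquiv.en_eq {s t : BinTree} (h : SwapEquiv s t) : s.en = t.en := by
  rw [BinTree.en_eq, BinTree.en_eq, h.polys_eq]

/-- Preservation of the root is needed in the induction, since a parent is adjacent exactly to the
roots of its subtrees. -/
theorem SwapEquiv.exists_graph_iso {s t : BinTree} (h : SwapEquiv s t) :
    ∃ e : s.graph ≃g t.graph, ∀ x, t.IsRoot (e x) ↔ s.IsRoot x := by
  induction h with
  | nil => exact ⟨SimpleGraph.Iso.refl, fun x => x.elim⟩
  | @congr a a' b b' _ _ h1 h2 =>
    obtain ⟨e, he⟩ := h1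
    obtain ⟨f, hf⟩ := h2
    let g : (node a b).Vert ≃ (node a' b').Vert :=
      (Equiv.refl Unit).sumCongr (e.toEquiv.sumCongr f.toEquiv)
    refine ⟨⟨g, ?_⟩, ?_⟩
    · rintro (x | x | x) (y | y | y)
      exacts [Iff.rfl, he y, hf y, he x, e.map_adj_iff, Iff.rfl, hf x, Iff.rfl, f.map_adj_iff]
    · rintro (x | x | x) <;> exact Iff.rfl
  | @swap a a' b b' _ _ h1 h2 =>
    obtain ⟨e, he⟩ := h1
    obtain ⟨f, hf⟩ := h2
    let g : (node a b).Vert ≃ (node b' a').Vert :=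
      (Equiv.refl Unit).sumCongr
        ((e.toEquiv.sumCongr f.toEquiv).trans (Equiv.sumComm _ _))
    refine ⟨⟨g, ?_⟩, ?_⟩
    · rintro (x | x | x) (y | y | y)
      exacts [Iff.rfl, he y, hf y, he x, e.map_adj_iff, Iff.rfl, hf x, Iff.rfl, f.map_adj_iff]
    · rintro (x | x | x) <;> exact Iff.rfl

theorem joinPoly_node_comm (a b c : BinTree) :
    joinPoly (node a b) c = joinPoly (node b a) c := by
  simp only [joinPoly, polys]; ring

/-- In the joined tree `a`, `b`, `c` are three branches at one vertex and play symmetric roles.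
Together with `joinPoly_node_comm` this permits all their permutations. -/
theorem joinPoly_node_left (a b c : BinTree) :
    joinPoly (node a b) c = joinPoly (node a c) b := by
  simp only [joinPoly, polys]; ring

theorem joinPoly_node_nil (a b : BinTree) : absRootSum (joinPoly (node a nil) b) = (node a b).en := by
  rw [en_eq]
  congr 1
  simp only [joinPoly, polys]
  ring

/-! ### Deficient trees, thin trees and blocks -/

/-- The rooted trees with at least one vertex whose energy is less than the order. -/
def Deficient (c : BinTree) : Prop :=
  c = leaf ∨ c = cherry ∨ c = path ∨ c = cherryStem ∨ c = doubleCherry ∨ c = leafDoubleCherry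

/-- The deficient rooted trees all of whose subtrees are deficient, and the empty tree. -/
def Thin (c : BinTree) : Prop :=
  c = nil ∨ c = leaf ∨ c = cherry ∨ c = cherryStem ∨ c = doubleCherry

/-- The minimal rooted trees that are not thin. -/
def Block (s : BinTree) : Prop :=
  s = edge ∨ s = node cherryStem nil ∨ s = node doubleCherry nil ∨ s = node leaf cherry ∨
  s = node leaf cherryStem ∨ s = node leaf doubleCherry ∨ s = node cherry cherryStem ∨
  s = node cherry doubleCherry ∨ s = node cherryStem cherryStem ∨
  s = node cherryStem doubleCherry ∨ s = node doubleCherry doubleCherry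

/-- The fifteen unordered pairs of thin trees give the four nonempty thin trees and the eleven
blocks. -/
theorem thin_or_block_node {a b : BinTree} (ha : Thin a) (hb : Thin b) :
    ∃ c, (Thin c ∨ Block c) ∧ (c = node a b ∨ c = node b a) := by
  rcases ha with rfl | rfl | rfl | rfl | rfl <;> rcases hb with rfl | rfl | rfl | rfl | rfl <;>
    solve
    | (refine ⟨_, ?_, Or.inl rfl⟩; simp [Thin, Block])
    | (refine ⟨_, ?_, Or.inr rfl⟩; simp [Thin, Block])

theorem exists_equiv_thin_or_block {l r a b : BinTree} (hl : SwapEquiv l a) (hr : SwapEquiv r b)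
    (ha : Thin a) (hb : Thin b) : ∃ c, (Thin c ∨ Block c) ∧ SwapEquiv (node l r) c := by
  obtain ⟨c, hc, rfl | rfl⟩ := thin_or_block_node ha hb
  · exact ⟨_, hc, .congr hl hr⟩
  · exact ⟨_, hc, .swap hl hr⟩

/-- Induction over the subtrees `u` of `t`, with `d` the remainder of `t`: if neither child contains
a block, both are thin, and then `u` itself is thin or a block. -/
theorem exists_split_block {t : BinTree} (u d : BinTree) (h : Split t u d) :
    (∃ c, Thin c ∧ SwapEquiv u c) ∨ ∃ s c b, Split t s c ∧ Block b ∧ SwapEquiv s b := by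
  induction u generalizing d with
  | nil => exact Or.inl ⟨nil, Or.inl rfl, .nil⟩
  | node l r hl hr =>
    rcases hl _ h.left with ⟨a, ha, hla⟩ | h1
    · rcases hr _ h.right with ⟨b, hb, hrb⟩ | h2
      · obtain ⟨c, hc | hc, he⟩ := exists_equiv_thin_or_block hla hrb ha hb
        · exact Or.inl ⟨c, hc, he⟩
        · exact Or.inr ⟨_, _, c, h, hc, he⟩
      · exact Or.inr h2
    · exact Or.inr h1

theorem Split.eq_of_nil {t s c : BinTree} (h : Split t s c) (hc : c = nil) : s = t := by
  cases h with
  | refl => rfl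
  | left => cases hc
  | right => cases hc

theorem Split.eq_of_leaf {t s c : BinTree} (h : Split t s c) (hc : c = leaf) :
    t = node s nil ∨ t = node nil s := by
  cases h with
  | refl => cases hc
  | left h => cases hc; exact Or.inl (h.eq_of_nil rfl).symm
  | right h => cases hc; exact Or.inr (h.eq_of_nil rfl).symm

/-! ### Joining a block to a deficient tree -/

/-- The order of a join is less than its energy. -/
def JoinBound (s c : BinTree) : Prop := (s.size + c.size : ℝ) < absRootSum (joinPoly s c)

/-- Used when the surplus of `s` over its order outweighs the deficit of `c`, so that pinching alone
suffices. -/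
theorem JoinBound.of_le {s c : BinTree} {x y : ℝ} (h : s.en + c.en ≤ absRootSum (joinPoly s c))
    (hs : x ≤ s.en) (hc : y ≤ c.en) (hxy : (s.size + c.size : ℝ) < x + y) : JoinBound s c :=
  hxy.trans_le ((add_le_add hs hc).trans h)

theorem le_en_cherry : 2.828 ≤ cherry.en := by
  have := sqrt_two_bounds; rw [en_cherry]; linarith

theorem le_en_path : 2.828 ≤ path.en := by
  have := sqrt_two_bounds; rw [en_path]; linarith

theorem le_en_cherryStem : 3.464 ≤ cherryStem.en := by
  have := sqrt_three_bounds; rw [en_cherryStem]; linarith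

theorem le_en_doubleCherry : 6.828 ≤ doubleCherry.en := by
  have := sqrt_two_bounds; rw [en_doubleCherry]; linarith

theorem le_en_leafDoubleCherry : 6.828 ≤ leafDoubleCherry.en := by
  have := sqrt_two_bounds; rw [en_leafDoubleCherry]; linarith

/-- Deficient trees other than a leaf and a cherry stem. -/
def AlmostTight (c : BinTree) : Prop :=
  c = cherry ∨ c = path ∨ c = doubleCherry ∨ c = leafDoubleCherry

/-- `P₃` and the seven-vertex tree have deficit below 0.172, which a surplus of 0.2 covers. The
deficits of `cherryStem` (about 0.54) and `leaf` (1) are larger, and these two trees are mostly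
handled by explicit polynomials. -/
theorem JoinBound.of_almostTight {s c : BinTree} (h : s.en + c.en ≤ absRootSum (joinPoly s c))
    (hs : s.size + 0.2 ≤ s.en) (hc : AlmostTight c) : JoinBound s c := by
  rcases hc with rfl | rfl | rfl | rfl
  · exact .of_le h hs le_en_cherry (by norm_num [size]; linarith)
  · exact .of_le h hs le_en_path (by norm_num [size]; linarith)
  · exact .of_le h hs le_en_doubleCherry (by norm_num [size]; linarith)
  · exact .of_le h hs le_en_leafDoubleCherry (by norm_num [size]; linarith)

theorem Deficient.cases {c : BinTree} (hc : Deficient c) :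
    AlmostTight c ∨ c = cherryStem ∨ c = leaf := by
  rcases hc with rfl | rfl | rfl | rfl | rfl | rfl <;> simp [AlmostTight]

theorem joinBound_edge {c : BinTree} (hc : Deficient c) : JoinBound edge c ∨ c = leaf := by
  rcases hc with rfl | rfl | rfl | rfl | rfl | rfl
  · exact Or.inr rfl
  all_goals refine Or.inl ?_
  all_goals rw [JoinBound]
  · rw [joinPoly_node_nil]
    exact lt_of_lt_of_le (by norm_num [size]) en_leaf_cherry
  · exact lt_of_lt_of_le (by norm_num [size]) join_edge_path
  · rw [joinPoly_node_nil]
    exact lt_of_lt_of_le (by norm_num [size]) en_leaf_stem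
  · rw [joinPoly_node_nil]
    exact lt_of_lt_of_le (by norm_num [size]) en_leaf_double
  · exact lt_of_lt_of_le (by norm_num [size]) join_edge_leafDouble

theorem joinBound_stem_nil {c : BinTree} (hc : Deficient c)
    (h : (node cherryStem nil).en + c.en ≤ absRootSum (joinPoly (node cherryStem nil) c)) :
    JoinBound (node cherryStem nil) c := by
  rcases hc.cases with hc | rfl | rfl
  · exact .of_almostTight h (le_trans (by norm_num [size]) en_stem_nil) hc
  · rw [JoinBound, joinPoly_node_nil]
    exact lt_of_lt_of_le (by norm_num [size]) en_stem_stem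
  · rw [JoinBound, joinPoly_node_left, joinPoly_node_comm, joinPoly_node_left, joinPoly_node_nil]
    exact lt_of_lt_of_le (by norm_num [size]) en_leaf_stem

theorem joinBound_double_nil {c : BinTree} (hc : Deficient c)
    (h : (node doubleCherry nil).en + c.en ≤ absRootSum (joinPoly (node doubleCherry nil) c)) :
    JoinBound (node doubleCherry nil) c := by
  rcases hc.cases with hc | rfl | rfl
  · exact .of_almostTight h (le_trans (by norm_num [size]) en_double_nil) hc
  · rw [JoinBound, joinPoly_node_left, joinPoly_node_comm, joinPoly_node_left, joinPoly_node_nil]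
    exact lt_of_lt_of_le (by norm_num [size]) en_stem_double
  · rw [JoinBound, joinPoly_node_left, joinPoly_node_comm, joinPoly_node_left, joinPoly_node_nil]
    exact lt_of_lt_of_le (by norm_num [size]) en_leaf_double

theorem joinBound_leaf_cherry {c : BinTree} (hc : Deficient c)
    (h : (node leaf cherry).en + c.en ≤ absRootSum (joinPoly (node leaf cherry) c)) :
    JoinBound (node leaf cherry) c ∨ c = leaf := by
  rcases hc.cases with hc | rfl | rfl
  · exact Or.inl (.of_almostTight h (le_trans (by norm_num [size]) en_leaf_cherry) hc)
  · exact Or.inl (lt_of_lt_of_le (by norm_num [size]) join_leaf_cherry_stem)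
  · exact Or.inr rfl

/-- The surplus of this block, about 0.155, does not reach the deficit 0.172, so each remainder
other than a leaf needs its own polynomial. -/
theorem joinBound_leaf_stem {c : BinTree} (hc : Deficient c)
    (h : (node leaf cherryStem).en + c.en ≤ absRootSum (joinPoly (node leaf cherryStem) c)) :
    JoinBound (node leaf cherryStem) c ∨ c = leaf := by
  rcases hc with rfl | rfl | rfl | rfl | rfl | rfl
  · exact Or.inr rfl
  all_goals refine Or.inl ?_
  all_goals rw [JoinBound]
  · rw [joinPoly_node_left]
    exact lt_of_lt_of_le (by norm_num [size]) join_leaf_cherry_stem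
  -- The same tree on nine vertices, cut at two different edges.
  · have hp : joinPoly (node leaf cherryStem) path = joinPoly edge leafDoubleCherry := by
      simp only [joinPoly, polys]; ring
    rw [hp]
    exact lt_of_lt_of_le (by norm_num [size]) join_edge_leafDouble
  · exact lt_of_lt_of_le (by norm_num [size]) join_leaf_stem_stem
  · exact lt_of_lt_of_le (by norm_num [size]) join_leaf_stem_double
  · exact lt_of_lt_of_le (by norm_num [size]) join_leafStem_leafDouble

theorem joinBound_leaf_double {c : BinTree} (hc : Deficient c)
    (h : (node leaf doubleCherry).en + c.en ≤ absRootSum (joinPoly (node leaf doubleCherry) c)) :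
    JoinBound (node leaf doubleCherry) c := by
  rcases hc.cases with hc | rfl | rfl
  · exact .of_almostTight h (le_trans (by norm_num [size]) en_leaf_double) hc
  · rw [JoinBound, joinPoly_node_left]
    exact lt_of_lt_of_le (by norm_num [size]) join_leaf_stem_double
  · rw [JoinBound, joinPoly_node_left]
    exact lt_of_lt_of_le (by norm_num [size]) join_leaf_leaf_double

theorem joinBound_cherry_stem {c : BinTree} (hc : Deficient c)
    (h : (node cherry cherryStem).en + c.en ≤ absRootSum (joinPoly (node cherry cherryStem) c)) :
    JoinBound (node cherry cherryStem) c := by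
  rcases hc.cases with hc | rfl | rfl
  · exact .of_almostTight h (le_trans (by norm_num [size]) en_cherry_stem) hc
  · exact lt_of_lt_of_le (by norm_num [size]) join_cherry_stem_stem
  · rw [JoinBound, joinPoly_node_left, joinPoly_node_comm]
    exact lt_of_lt_of_le (by norm_num [size]) join_leaf_cherry_stem

theorem joinBound_cherry_double {c : BinTree} (hc : Deficient c)
    (h : (node cherry doubleCherry).en + c.en
      ≤ absRootSum (joinPoly (node cherry doubleCherry) c)) :
    JoinBound (node cherry doubleCherry) c := by
  rcases hc.cases with hc | rfl | rfl
  · exact .of_almostTight h (le_trans (by norm_num [size]) en_cherry_double) hc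
  · exact .of_le h en_cherry_double le_en_cherryStem (by norm_num [size])
  · rw [JoinBound, joinPoly_node_left, joinPoly_node_comm]
    exact lt_of_lt_of_le (by norm_num [size]) join_leaf_cherry_double

theorem joinBound_stem_stem {c : BinTree} (hc : Deficient c)
    (h : (node cherryStem cherryStem).en + c.en
      ≤ absRootSum (joinPoly (node cherryStem cherryStem) c)) :
    JoinBound (node cherryStem cherryStem) c := by
  rcases hc.cases with hc | rfl | rfl
  · exact .of_almostTight h (le_trans (by norm_num [size]) en_stem_stem) hc
  · exact lt_of_lt_of_le (by norm_num [size]) join_stem_stem_stem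
  · rw [JoinBound, joinPoly_node_left, joinPoly_node_comm]
    exact lt_of_lt_of_le (by norm_num [size]) join_leaf_stem_stem

theorem joinBound_stem_double {c : BinTree} (hc : Deficient c)
    (h : (node cherryStem doubleCherry).en + c.en
      ≤ absRootSum (joinPoly (node cherryStem doubleCherry) c)) :
    JoinBound (node cherryStem doubleCherry) c := by
  rcases hc.cases with hc | rfl | rfl
  · exact .of_almostTight h (le_trans (by norm_num [size]) en_stem_double) hc
  · exact .of_le h en_stem_double le_en_cherryStem (by norm_num [size])
  · rw [JoinBound, joinPoly_node_left, joinPoly_node_comm]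
    exact lt_of_lt_of_le (by norm_num [size]) join_leaf_stem_double

theorem joinBound_double_double {c : BinTree} (hc : Deficient c)
    (h : (node doubleCherry doubleCherry).en + c.en
      ≤ absRootSum (joinPoly (node doubleCherry doubleCherry) c)) :
    JoinBound (node doubleCherry doubleCherry) c := by
  rcases hc.cases with hc | rfl | rfl
  · exact .of_almostTight h (le_trans (by norm_num [size]) en_double_double) hc
  · exact .of_le h en_double_double le_en_cherryStem (by norm_num [size])
  · rw [JoinBound, joinPoly_node_left, joinPoly_node_comm]
    exact lt_of_lt_of_le (by norm_num [size]) join_leaf_double_double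

/-- The three exceptions are genuine: joined to a single vertex, these blocks become `path`, `leafQ`
and `leafDoubleCherry`. -/
theorem joinBound_block {s c : BinTree} (hs : Block s) (hc : Deficient c)
    (h : s.en + c.en ≤ absRootSum (joinPoly s c)) :
    JoinBound s c ∨
      c = leaf ∧ (s = edge ∨ s = node leaf cherry ∨ s = node leaf cherryStem) := by
  rcases hs with rfl | rfl | rfl | rfl | rfl | rfl | rfl | rfl | rfl | rfl | rfl
  · exact (joinBound_edge hc).imp_right fun hc => ⟨hc, Or.inl rfl⟩
  · exact Or.inl (joinBound_stem_nil hc h)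
  · exact Or.inl (joinBound_double_nil hc h)
  · exact (joinBound_leaf_cherry hc h).imp_right fun hc => ⟨hc, Or.inr (Or.inl rfl)⟩
  · exact (joinBound_leaf_stem hc h).imp_right fun hc => ⟨hc, Or.inr (Or.inr rfl)⟩
  · exact Or.inl (joinBound_leaf_double hc h)
  · exact Or.inl (joinBound_cherry_stem hc h)
  · exact Or.inl (joinBound_cherry_double hc h)
  · exact Or.inl (joinBound_stem_stem hc h)
  · exact Or.inl (joinBound_stem_double hc h)
  · exact Or.inl (joinBound_double_double hc h)

theorem Block.eq_edge_or_lt_en {s : BinTree} (hs : Block s) : s = edge ∨ (s.size : ℝ) < s.en := by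
  rcases hs with rfl | rfl | rfl | rfl | rfl | rfl | rfl | rfl | rfl | rfl | rfl
  · exact Or.inl rfl
  all_goals right
  · exact lt_of_lt_of_le (by norm_num [size]) en_stem_nil
  · exact lt_of_lt_of_le (by norm_num [size]) en_double_nil
  · exact lt_of_lt_of_le (by norm_num [size]) en_leaf_cherry
  · exact lt_of_lt_of_le (by norm_num [size]) en_leaf_stem
  · exact lt_of_lt_of_le (by norm_num [size]) en_leaf_double
  · exact lt_of_lt_of_le (by norm_num [size]) en_cherry_stem
  · exact lt_of_lt_of_le (by norm_num [size]) en_cherry_double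
  · exact lt_of_lt_of_le (by norm_num [size]) en_stem_stem
  · exact lt_of_lt_of_le (by norm_num [size]) en_stem_double
  · exact lt_of_lt_of_le (by norm_num [size]) en_double_double

/-! ### The induction on the order -/

/-- Every nonempty binary tree has energy greater than its order, up to eight exceptions. -/
theorem lt_en_or_exists_swapEquiv (t : BinTree) (ht : t ≠ nil) :
    (t.size : ℝ) < t.en ∨ ∃ c, SwapEquiv t c ∧ (Deficient c ∨ c = edge ∨ c = leafQ) := by
  induction hn : t.size using Nat.strong_induction_on generalizing t with
  | _ n ih =>
  subst hn
  rcases exists_split_block t nil .refl with ⟨c, hc, he⟩ | ⟨s, c, b, hsplit, hb, he⟩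
  · refine Or.inr ⟨c, he, Or.inl ?_⟩
    rcases hc with rfl | rfl | rfl | rfl | rfl
    · exact (ht (by cases he; rfl)).elim
    all_goals simp [Deficient]
  have hpinch := hsplit.en_add_le
  have hsize := hsplit.size_eq
  have hsize' : (t.size : ℝ) = s.size + c.size := by rw [hsize]; push_cast; rfl
  rw [he.en_eq] at hpinch
  have hsb := he.size_eq
  by_cases hc : c = nil
  · have hst := hsplit.eq_of_nil hc
    subst hst
    rcases hb.eq_edge_or_lt_en with rfl | hlt
    · exact Or.inr ⟨_, he, Or.inr (Or.inl rfl)⟩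
    · left
      rwa [he.size_eq, he.en_eq]
  have hbpos : 0 < b.size := by
    rcases hb with rfl | rfl | rfl | rfl | rfl | rfl | rfl | rfl | rfl | rfl | rfl <;>
      simp only [size] <;> omega
  -- If the remainder has energy greater than its order, pinching concludes, as a block has energy
  -- at least its order. Otherwise the remainder is, up to swaps, one of the eight exceptions.
  rcases ih c.size (by omega) c hc rfl with hlt | ⟨c', hcc', hc'⟩
  · left
    have : (s.size : ℝ) ≤ b.en := by
      rw [hsb]
      rcases hb.eq_edge_or_lt_en with rfl | hlt
      · rw [en_edge]; norm_num [size]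
      · exact hlt.le
    linarith
  have hten : t.en = absRootSum (joinPoly b c') := by
    rw [hsplit.en_eq, joinPoly, joinPoly, he.polys_eq, hcc'.polys_eq]
  rw [hcc'.en_eq] at hpinch
  have hfin : JoinBound b c' → (t.size : ℝ) < t.en := fun h => by
    rw [hsize', hsb, hcc'.size_eq, hten]
    exact h
  rcases hc' with hc' | hc'
  · rcases joinBound_block hb hc' (hten ▸ hpinch) with h | ⟨rfl, h⟩
    · exact Or.inl (hfin h)
    · have hcl : c = leaf := by
        cases hcc' with
        | congr h1 h2 => cases h1; cases h2; rfl
        | swap h1 h2 => cases h1; cases h2; rfl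
      -- A remainder consisting of one vertex must be the root of `t`, with the block as its only
      -- subtree.
      have ht' : SwapEquiv t (node b nil) := by
        rcases hsplit.eq_of_leaf hcl with rfl | rfl
        · exact .congr he .nil
        · exact .swap .nil he
      refine Or.inr ⟨_, ht', ?_⟩
      rcases h with rfl | rfl | rfl <;> simp [Deficient]
  · left
    apply hfin
    -- Here the remainder is `K₂` or `Q`, with energy equal to its order. Pinching is strict enough
    -- unless the block is `K₂` too, where explicit polynomials decide.
    rcases hb.eq_edge_or_lt_en with rfl | hlt
    · rcases hc' with rfl | rfl
      · exact lt_of_lt_of_le (by norm_num [size]) join_edge_edge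
      · exact lt_of_lt_of_le (by norm_num [size]) join_edge_leafQ
    · have : (c'.size : ℝ) ≤ c'.en := by
        rcases hc' with rfl | rfl
        · rw [en_edge]; norm_num [size]
        · rw [en_leafQ]; norm_num [size]
      rw [JoinBound, ← hten]
      linarith

end BinTree

/-! ### From trees of maximum degree three to binary trees -/

/-- Attach a pendent vertex to a graph. -/
def addLeaf {U : Type*} (G : SimpleGraph U) (x : U) : SimpleGraph (Option U) where
  Adj
    | none, none => False
    | none, some y => y = x
    | some y, none => y = x
    | some y, some z => G.Adj y z
  symm := ⟨by
    rintro (_ | y) (_ | z) h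
    exacts [h, h, h, SimpleGraph.Adj.symm h]⟩
  loopless := ⟨by
    rintro (_ | y) h
    exacts [h, G.irrefl h]⟩

namespace BinTree

/-- The inclusion of the left subtree. -/
def inLeft (l r : BinTree) : l.Vert ↪ (node l r).Vert :=
  ⟨fun y => .inr (.inl y), fun _ _ h => Sum.inl.inj (Sum.inr.inj h)⟩

/-- The inclusion of the right subtree. -/
def inRight (l r : BinTree) : r.Vert ↪ (node l r).Vert :=
  ⟨fun y => .inr (.inr y), fun _ _ h => Sum.inr.inj (Sum.inr.inj h)⟩

/-- The root of a node. -/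
def top (l r : BinTree) : (node l r).Vert := .inl ()

/-- The predicate of having two children. -/
def Full : (t : BinTree) → t.Vert → Prop
  | node l r, .inl _ => l ≠ nil ∧ r ≠ nil
  | node l _, .inr (.inl x) => l.Full x
  | node _ r, .inr (.inr x) => r.Full x

theorem exists_isRoot {t : BinTree} (ht : t ≠ nil) : ∃ x, t.IsRoot x := by
  cases t with
  | nil => exact (ht rfl).elim
  | node l r => exact ⟨top l r, trivial⟩

/-- The neighbours found in a subtree persist in the larger tree, and the root of the subtree gains
its parent `v`, so its two neighbours become three. -/
theorem exists_neighbors_map {s t : BinTree} {x : s.Vert} (i : s.Vert ↪ t.Vert) (v : t.Vert)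
    (hv : ∀ y, i y ≠ v) (hi : ∀ y, s.Adj x y → t.Adj (i x) (i y)) (hx : s.IsRoot x → t.Adj (i x) v)
    (h : ∃ S : Finset s.Vert, (∀ y ∈ S, s.Adj x y) ∧ 2 ≤ S.card ∧ (3 ≤ S.card ∨ s.IsRoot x)) :
    ∃ S : Finset t.Vert, (∀ y ∈ S, t.Adj (i x) y) ∧ 2 ≤ S.card ∧
      (3 ≤ S.card ∨ t.IsRoot (i x)) := by
  obtain ⟨S, hS, h2, h3⟩ := h
  have hmap : ∀ y ∈ S.map i, t.Adj (i x) y := fun y hy => by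
    obtain ⟨z, hz, rfl⟩ := Finset.mem_map.1 hy
    exact hi z (hS z hz)
  rcases h3 with h3 | h3
  · exact ⟨S.map i, hmap, by rwa [Finset.card_map], Or.inl (by rwa [Finset.card_map])⟩
  · have hn : v ∉ S.map i := fun hy => by
      obtain ⟨z, -, hz⟩ := Finset.mem_map.1 hy
      exact hv z hz
    refine ⟨(S.map i).cons v hn, fun y hy => ?_, ?_, Or.inl ?_⟩
    · rcases Finset.mem_cons.1 hy with rfl | hy
      · exact hx h3
      · exact hmap y hy
    all_goals rw [Finset.card_cons, Finset.card_map]; omega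

/-- A vertex with two children has its parent as third neighbour, unless it is the root. This is
what prevents a fourth neighbour from being attached under the degree bound. -/
theorem Full.exists_neighbors {t : BinTree} {x : t.Vert} (h : t.Full x) :
    ∃ S : Finset t.Vert, (∀ y ∈ S, t.Adj x y) ∧ 2 ≤ S.card ∧ (3 ≤ S.card ∨ t.IsRoot x) := by
  induction t with
  | nil => exact x.elim
  | node l r hl hr =>
    rcases x with x | x | x
    · obtain ⟨a, ha⟩ := exists_isRoot h.1
      obtain ⟨b, hb⟩ := exists_isRoot h.2
      refine ⟨{inLeft l r a, inRight l r b}, ?_, ?_, Or.inr trivial⟩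
      · intro y hy
        rcases Finset.mem_insert.1 hy with rfl | hy
        · exact ha
        · rw [Finset.mem_singleton.1 hy]
          exact hb
      · rw [Finset.card_pair]
        rintro ⟨⟩
    · exact exists_neighbors_map (inLeft l r) (top l r) (by rintro y ⟨⟩) (fun _ h => h)
        (fun h => h) (hl h)
    · exact exists_neighbors_map (inRight l r) (top l r) (by rintro y ⟨⟩) (fun _ h => h)
        (fun h => h) (hr h)

/-- Moving an additional point into the left part of a sum. -/
def optionSumLeft (L R : Type) : Option (Unit ⊕ (L ⊕ R)) ≃ Unit ⊕ (Option L ⊕ R) where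
  toFun
    | none => .inr (.inl none)
    | some (.inl u) => .inl u
    | some (.inr (.inl y)) => .inr (.inl (some y))
    | some (.inr (.inr y)) => .inr (.inr y)
  invFun
    | .inr (.inl none) => none
    | .inl u => some (.inl u)
    | .inr (.inl (some y)) => some (.inr (.inl y))
    | .inr (.inr y) => some (.inr (.inr y))
  left_inv := by rintro (_ | _ | _ | _) <;> rfl
  right_inv := by rintro (_ | (_ | _) | _) <;> rfl

/-- Covers two situations at once: the new vertex hangs from a vertex of `l`, or it hangs from the
root and becomes the root of `l'`, with `l` empty. `hnone` and `htop` record which neighbour it has.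
-/
theorem exists_addLeaf_left {l l' r : BinTree} (g : Option l.Vert ≃ l'.Vert) {x : (node l r).Vert}
    (hg : ∀ y z, l'.Adj (g (some y)) (g (some z)) ↔ l.Adj y z)
    (hroot : ∀ y, l'.IsRoot (g (some y)) ↔ l.IsRoot y)
    (hnone : ∀ y, l'.Adj (g none) (g (some y)) ↔ inLeft l r y = x)
    (htop : l'.IsRoot (g none) ↔ top l r = x) (hright : ∀ y, inRight l r y ≠ x) :
    ∃ e : addLeaf (node l r).graph x ≃g (node l' r).graph,
      (∀ y, (node l' r).IsRoot (e (some y)) ↔ (node l r).IsRoot y) ∧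
        ¬ (node l' r).IsRoot (e none) := by
  let f : Option (node l r).Vert ≃ (node l' r).Vert :=
    (optionSumLeft l.Vert r.Vert).trans ((Equiv.refl Unit).sumCongr (g.sumCongr (Equiv.refl _)))
  have hsymm : ∀ a b, l'.Adj a b ↔ l'.Adj b a := fun a b => ⟨adj_symm, adj_symm⟩
  refine ⟨⟨f, ?_⟩, ?_, not_false⟩
  · rintro (_ | u | y | y) (_ | v | z | z)
    exacts [iff_of_false (adj_irrefl _) not_false, htop, hnone z,
      iff_of_false not_false (hright z), htop, Iff.rfl, hroot z, Iff.rfl,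
      (hsymm _ _).trans (hnone y), hroot y, hg y z, Iff.rfl, iff_of_false not_false (hright y),
      Iff.rfl, Iff.rfl, Iff.rfl]
  · rintro (u | y | y) <;> exact Iff.rfl

/-- Exchanging the two subtrees of a node. -/
def swapIso (l r : BinTree) : (node l r).graph ≃g (node r l).graph where
  toEquiv := (Equiv.refl Unit).sumCongr (Equiv.sumComm l.Vert r.Vert)
  map_rel_iff' := by
    rintro (_ | _ | _) (_ | _ | _) <;> exact Iff.rfl

theorem isRoot_swapIso {l r : BinTree} (y : (node l r).Vert) :
    (node r l).IsRoot (swapIso l r y) ↔ (node l r).IsRoot y := by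
  rcases y with y | y | y <;> exact Iff.rfl

end BinTree

/-- Attaching pendent vertices is compatible with isomorphisms. -/
def addLeafCongr {U W : Type*} {G : SimpleGraph U} {H : SimpleGraph W} (e : G ≃g H) (x : U) :
    addLeaf G x ≃g addLeaf H (e x) where
  toEquiv := e.toEquiv.optionCongr
  map_rel_iff' := by
    rintro (_ | y) (_ | z)
    exacts [Iff.rfl, e.injective.eq_iff, e.injective.eq_iff, e.map_adj_iff]

namespace BinTree

/-- A pendent vertex attached to a vertex with at most one child yields a binary tree with the
same root. -/
theorem exists_addLeaf_iso {t : BinTree} {x : t.Vert} (h : ¬ t.Full x) :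
    ∃ (t' : BinTree) (e : addLeaf t.graph x ≃g t'.graph),
      (∀ y, t'.IsRoot (e (some y)) ↔ t.IsRoot y) ∧ ¬ t'.IsRoot (e none) := by
  induction t with
  | nil => exact x.elim
  | node l r hl hr =>
    -- Exchanging the children reduces attachments on the right to attachments on the left.
    have hswap : ∀ l r : BinTree, ∀ x : (node l r).Vert,
        (∃ (t' : BinTree) (e : addLeaf (node r l).graph (swapIso l r x) ≃g t'.graph),
          (∀ y, t'.IsRoot (e (some y)) ↔ (node r l).IsRoot y) ∧ ¬ t'.IsRoot (e none)) →
        ∃ (t' : BinTree) (e : addLeaf (node l r).graph x ≃g t'.graph),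
          (∀ y, t'.IsRoot (e (some y)) ↔ (node l r).IsRoot y) ∧ ¬ t'.IsRoot (e none) := by
      rintro l r x ⟨t', e, he, hn⟩
      exact ⟨t', (addLeafCongr (swapIso l r) x).trans e,
        fun y => (he (swapIso l r y)).trans (isRoot_swapIso y), hn⟩
    have htop : ∀ r : BinTree, ∃ (t' : BinTree)
        (e : addLeaf (node nil r).graph (top nil r) ≃g t'.graph),
        (∀ y, t'.IsRoot (e (some y)) ↔ (node nil r).IsRoot y) ∧ ¬ t'.IsRoot (e none) := by
      intro r
      let g : Option nil.Vert ≃ leaf.Vert :=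
        { toFun := fun _ => .inl ()
          invFun := fun _ => none
          left_inv := by rintro (_ | y); exacts [rfl, y.elim]
          right_inv := by rintro (_ | y | y); exacts [rfl, y.elim, y.elim] }
      exact ⟨node leaf r, exists_addLeaf_left g (fun y => y.elim) (fun y => y.elim)
        (fun y => y.elim) (iff_of_true trivial rfl) (by rintro y ⟨⟩)⟩
    have hinner : ∀ (l r : BinTree) (x : l.Vert),
        (∃ (t' : BinTree) (e : addLeaf l.graph x ≃g t'.graph),
          (∀ y, t'.IsRoot (e (some y)) ↔ l.IsRoot y) ∧ ¬ t'.IsRoot (e none)) →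
        ∃ (t' : BinTree) (e : addLeaf (node l r).graph (inLeft l r x) ≃g t'.graph),
          (∀ y, t'.IsRoot (e (some y)) ↔ (node l r).IsRoot y) ∧ ¬ t'.IsRoot (e none) := by
      rintro l r x ⟨t', e, he, hn⟩
      exact ⟨node t' r, exists_addLeaf_left e.toEquiv (fun y z => e.map_adj_iff) he
        (fun y => (e.map_adj_iff (v := none) (w := some y)).trans
          (inLeft l r).injective.eq_iff.symm) (iff_of_false hn (by rintro ⟨⟩))
        (by rintro y ⟨⟩)⟩
    rcases x with x | x | x
    · by_cases hnl : l = nil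
      · subst hnl
        exact htop r
      · have hnr : r = nil := by
          by_contra hnr
          exact h ⟨hnl, hnr⟩
        subst hnr
        exact hswap l nil _ (htop l)
    · exact hinner l r x (hl h)
    · exact hswap l r _ (hinner r l x (hr h))

/-- A pendent vertex attached to a root with at most one child can be taken as the new root. -/
theorem exists_addLeaf_top_iso (t : BinTree) :
    Nonempty (addLeaf (node t nil).graph (top t nil) ≃g (node (node t nil) nil).graph) := by
  let f : Option (node t nil).Vert ≃ (node (node t nil) nil).Vert :=
    { toFun := fun
        | none => .inl ()
        | some y => .inr (.inl y)
      invFun := fun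
        | .inl _ => none
        | .inr (.inl y) => some y
        | .inr (.inr y) => y.elim
      left_inv := by rintro (_ | _) <;> rfl
      right_inv := by rintro (_ | _ | y); exacts [rfl, rfl, y.elim] }
  have hroot : ∀ y, (node t nil).IsRoot y ↔ y = top t nil := by
    rintro (y | y)
    · exact iff_of_true trivial rfl
    · exact iff_of_false not_false (by rintro ⟨⟩)
  refine ⟨⟨f, ?_⟩⟩
  rintro (_ | y) (_ | z)
  exacts [Iff.rfl, hroot z, hroot y, Iff.rfl]

end BinTree

open BinTree

/-- Every finite tree with maximum degree at most three is the graph of a binary tree. -/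
theorem exists_binTree_iso {V : Type*} [Finite V] {T : SimpleGraph V} (hT : T.IsTree)
    (hdeg : ∀ (v : V) (S : Finset V), (∀ u ∈ S, T.Adj v u) → S.card ≤ 3) :
    ∃ t : BinTree, Nonempty (T ≃g (node t nil).graph) := by
  classical
  induction hn : Nat.card V using Nat.strong_induction_on generalizing V with
  | _ n ih =>
  have := Fintype.ofFinite V
  have := hT.connected.nonempty
  rcases subsingleton_or_nontrivial V with hV | hV
  · obtain ⟨v⟩ := this
    let f : V ≃ leaf.Vert :=
      { toFun := fun _ => .inl ()
        invFun := fun _ => v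
        left_inv := fun w => Subsingleton.elim _ _
        right_inv := by rintro (_ | y | y); exacts [rfl, y.elim, y.elim] }
    refine ⟨nil, ⟨⟨f, fun {a b} => iff_of_false not_false ?_⟩⟩⟩
    rw [Subsingleton.elim a b]
    exact T.irrefl
  -- Induction by removing a vertex `v` of degree one, encoding the remaining tree, and attaching
  -- `v` again at its neighbour `w`.
  · obtain ⟨v, hv⟩ := hT.exists_vert_degree_one_of_nontrivial
    have hT' : (T.induce {v}ᶜ).IsTree :=
      ⟨hT.connected.induce_compl_singleton_of_degree_eq_one hv, hT.isAcyclic.induce _⟩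
    obtain ⟨w, hvw, hw⟩ := SimpleGraph.degree_eq_one_iff_existsUnique_adj.1 hv
    have hwv : w ∈ ({v}ᶜ : Set V) := fun h => hvw.ne (Set.mem_singleton_iff.1 h).symm
    have hcard : Nat.card ({v}ᶜ : Set V) < n := by
      rw [← hn]
      exact Finite.card_subtype_lt (x := v) (by simp)
    obtain ⟨t, ⟨f⟩⟩ := ih _ hcard hT' (fun a S hS => by
      rw [← Finset.card_map (Function.Embedding.subtype _)]
      refine hdeg a _ fun u hu => ?_
      obtain ⟨z, hz, rfl⟩ := Finset.mem_map.1 hu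
      exact hS z hz) rfl
    set x := f ⟨w, hwv⟩ with hx
    let φ : addLeaf (node t nil).graph x ≃g T := by
      refine ⟨f.toEquiv.optionCongr.symm.trans (Equiv.optionSubtypeNe v), ?_⟩
      have hφ : ∀ y, T.Adj v (f.symm y).1 ↔ y = x := fun y => by
        rw [hx, ← f.symm_apply_eq, Subtype.ext_iff]
        exact ⟨hw _, fun h => by rw [h]; exact hvw⟩
      rintro (_ | y) (_ | z)
      · exact iff_of_false T.irrefl not_false
      · exact hφ z
      · exact (T.adj_comm _ _).trans (hφ y)
      · exact f.symm.map_adj_iff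
    have hfull : ¬ (node t nil).Full x := fun hfull => by
      obtain ⟨S, hS, h2, h3⟩ := hfull.exists_neighbors
      -- The root of `node t nil` has at most one child, so a full vertex is not the root and has
      -- three neighbours. With `v` added, `w` would have four.
      have h3 : 3 ≤ S.card := by
        refine h3.resolve_right fun hr => ?_
        rcases x with x | x
        · exact hfull.2 rfl
        · exact hr
      let i : (node t nil).Vert ↪ V := f.symm.toEquiv.toEmbedding.trans (.subtype _)
      have hnv : v ∉ S.map i := fun hmem => by
        obtain ⟨y, -, hy⟩ := Finset.mem_map.1 hmem
        exact (f.symm y).2 hy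
      have := hdeg w ((S.map i).cons v hnv) fun u hu => by
        rcases Finset.mem_cons.1 hu with rfl | hu
        · exact hvw.symm
        · obtain ⟨y, hy, rfl⟩ := Finset.mem_map.1 hu
          have h1 : (T.induce {v}ᶜ).Adj (f.symm x) (f.symm y) := f.symm.map_adj_iff.2 (hS y hy)
          rw [hx, f.symm_apply_apply] at h1
          exact h1
      rw [Finset.card_cons, Finset.card_map] at this
      omega
    -- To keep a root with at most one child, a vertex attached at the root becomes the new root;
    -- any other attachment takes place inside `t`.
    have key : ∃ t', Nonempty (addLeaf (node t nil).graph x ≃g (node t' nil).graph) := by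
      rcases hxt : x with u | u | u
      · exact ⟨_, exists_addLeaf_top_iso t⟩
      · rw [hxt] at hfull
        obtain ⟨t', e, he, hn⟩ := exists_addLeaf_iso (t := t) (x := u) hfull
        obtain ⟨e', -⟩ := exists_addLeaf_left (r := nil) (x := inLeft t nil u) e.toEquiv
          (fun y z => e.map_adj_iff) he
          (fun y => (e.map_adj_iff (v := none) (w := some y)).trans
            (inLeft t nil).injective.eq_iff.symm) (iff_of_false hn (by rintro ⟨⟩))
          (by rintro y ⟨⟩)
        exact ⟨t', ⟨e'⟩⟩
      · exact u.elim
    obtain ⟨t', ⟨e⟩⟩ := key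
    exact ⟨t', ⟨φ.symm.trans e⟩⟩

/-! ### The extremal trees `S₂` and `Q` -/

/-- The vertices of `edge` as elements of `Fin 2`. -/
def edgeEquivFin : edge.Vert ≃ Fin 2 where
  toFun
    | .inl _ => 0
    | .inr (.inl (.inl _)) => 1
    | .inr (.inl (.inr (.inl y))) => y.elim
    | .inr (.inl (.inr (.inr y))) => y.elim
    | .inr (.inr y) => y.elim
  invFun
    | 0 => .inl ()
    | 1 => .inr (.inl (.inl ()))
  left_inv := by
    rintro (_ | (_ | y | y) | y)
    exacts [rfl, rfl, y.elim, y.elim, y.elim]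
  right_inv := by intro i; fin_cases i <;> rfl

theorem edge_iso_S₂ : Nonempty (edge.graph ≃g S₂) := by
  refine ⟨⟨edgeEquivFin, ?_⟩⟩
  rintro (_ | (_ | y | y) | y) (_ | (_ | z | z) | z)
  all_goals first
    | exact y.elim
    | exact z.elim
    | exact iff_of_true (show (0 : Fin 2) ≠ 1 by decide) trivial
    | exact iff_of_true (show (1 : Fin 2) ≠ 0 by decide) trivial
    | exact iff_of_false S₂.irrefl not_false

theorem Q_adj {a b : Fin 6} : Q.Adj a b ↔
    s(a, b) ∈ ({s(0, 1), s(0, 2), s(0, 3), s(1, 4), s(1, 5)} : Finset (Sym2 (Fin 6))) := by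
  rw [Q, SimpleGraph.fromEdgeSet_adj]
  constructor
  · rintro ⟨h, -⟩
    simpa using h
  · intro h
    refine ⟨by simpa using h, ?_⟩
    rintro rfl
    revert h a
    decide

instance : DecidableRel Q.Adj := fun _ _ => decidable_of_iff _ Q_adj.symm

/-- The vertices of `leafQ` as elements of `Fin 6`. -/
def leafQEquivFin : leafQ.Vert ≃ Fin 6 where
  toFun
    | .inl _ => 2
    | .inr (.inl (.inl _)) => 0
    | .inr (.inl (.inr (.inl (.inl _)))) => 3
    | .inr (.inl (.inr (.inr (.inl _)))) => 1
    | .inr (.inl (.inr (.inr (.inr (.inl (.inl _)))))) => 4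
    | .inr (.inl (.inr (.inr (.inr (.inr (.inl _)))))) => 5
    | .inr (.inr y) => y.elim
    | .inr (.inl (.inr (.inl (.inr (.inl y))))) => y.elim
    | .inr (.inl (.inr (.inl (.inr (.inr y))))) => y.elim
    | .inr (.inl (.inr (.inr (.inr (.inl (.inr (.inl y))))))) => y.elim
    | .inr (.inl (.inr (.inr (.inr (.inl (.inr (.inr y))))))) => y.elim
    | .inr (.inl (.inr (.inr (.inr (.inr (.inr (.inl y))))))) => y.elim
    | .inr (.inl (.inr (.inr (.inr (.inr (.inr (.inr y))))))) => y.elim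
  invFun
    | 0 => .inr (.inl (.inl ()))
    | 1 => .inr (.inl (.inr (.inr (.inl ()))))
    | 2 => .inl ()
    | 3 => .inr (.inl (.inr (.inl (.inl ()))))
    | 4 => .inr (.inl (.inr (.inr (.inr (.inl (.inl ()))))))
    | 5 => .inr (.inl (.inr (.inr (.inr (.inr (.inl ()))))))
  left_inv := by
    rintro (_ | (_ | (_ | y | y) | (_ | (_ | y | y) | (_ | y | y))) | y) <;>
      first | rfl | exact y.elim
  right_inv := by intro i; fin_cases i <;> rfl

theorem leafQ_iso_Q : Nonempty (leafQ.graph ≃g Q) := by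
  suffices h : Q ≃g leafQ.graph from ⟨h.symm⟩
  refine ⟨leafQEquivFin.symm, fun {i j} => ?_⟩
  fin_cases i <;> fin_cases j
  all_goals first
    | exact iff_of_true trivial (Q_adj.2 (by decide))
    | exact iff_of_false not_false (fun h => absurd (Q_adj.1 h) (by decide))

theorem isTree_S₂ : S₂.IsTree := by
  refine SimpleGraph.isTree_iff_connected_and_card.2 ⟨SimpleGraph.connected_top, ?_⟩
  rw [S₂, Nat.card_eq_fintype_card, Nat.card_eq_fintype_card, ← SimpleGraph.edgeFinset_card,
    SimpleGraph.card_edgeFinset_top_eq_card_choose_two]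
  rfl

theorem connected_Q : Q.Connected := by
  have h : ∀ v, Q.Reachable 0 v := fun v => by
    have h01 : Q.Adj 0 1 := by decide
    fin_cases v
    · exact SimpleGraph.Reachable.refl 0
    · exact h01.reachable
    · exact (show Q.Adj 0 2 by decide).reachable
    · exact (show Q.Adj 0 3 by decide).reachable
    · exact h01.reachable.trans (show Q.Adj 1 4 by decide).reachable
    · exact h01.reachable.trans (show Q.Adj 1 5 by decide).reachable
  exact (SimpleGraph.connected_iff _).2 ⟨fun u v => (h u).symm.trans (h v), ⟨0⟩⟩

theorem isTree_Q : Q.IsTree := by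
  refine SimpleGraph.isTree_iff_connected_and_card.2 ⟨connected_Q, ?_⟩
  rw [Nat.card_eq_fintype_card, Nat.card_eq_fintype_card, ← SimpleGraph.edgeFinset_card]
  decide

theorem BinTree.Deficient.en_lt_size {c : BinTree} (hc : Deficient c) : c.en < c.size := by
  have h2 := sqrt_two_bounds.2
  have h3 := sqrt_three_bounds.2
  rcases hc with rfl | rfl | rfl | rfl | rfl | rfl
  · rw [en_leaf]; norm_num [size]
  · rw [en_cherry]; norm_num [size]; linarith
  · rw [en_path]; norm_num [size]; linarith
  · rw [en_cherryStem]; norm_num [size]; linarith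
  · rw [en_doubleCherry]; norm_num [size]; linarith
  · rw [en_leafDoubleCherry]; norm_num [size]; linarith

/-- A binary tree whose energy equals its order represents `S₂` or `Q`. -/
theorem iso_of_en_eq_size {t : BinTree} (ht : t ≠ nil) (h : t.en = t.size) :
    Nonempty (t.graph ≃g S₂) ∨ Nonempty (t.graph ≃g Q) := by
  rcases lt_en_or_exists_swapEquiv t ht with hlt | ⟨c, he, hc | rfl | rfl⟩
  · exact absurd h hlt.ne'
  · rw [he.en_eq, he.size_eq] at h
    exact absurd h hc.en_lt_size.ne
  · obtain ⟨e, -⟩ := he.exists_graph_iso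
    obtain ⟨f⟩ := edge_iso_S₂
    exact Or.inl ⟨e.trans f⟩
  · obtain ⟨e, -⟩ := he.exists_graph_iso
    obtain ⟨f⟩ := leafQ_iso_Q
    exact Or.inr ⟨e.trans f⟩

end GraphEnergy

open GraphEnergy BinTree

theorem theorem2p5 {V : Type*} [Fintype V] [DecidableEq V] (T : SimpleGraph V)
    [DecidableRel T.Adj] :
    (T.IsTree ∧ T.maxDegree ≤ 3 ∧ GraphEnergy.energy T = (Fintype.card V : ℝ)) ↔
      (Nonempty (T ≃g GraphEnergy.S₂) ∨ Nonempty (T ≃g GraphEnergy.Q)) := by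
  classical
  constructor
  · rintro ⟨hT, hdeg, hE⟩
    obtain ⟨t, ⟨e⟩⟩ := exists_binTree_iso hT fun v S hS => by
      refine le_trans (Finset.card_le_card fun u hu => ?_) ((T.degree_le_maxDegree v).trans hdeg)
      exact (T.mem_neighborFinset v u).2 (hS u hu)
    have hcard : Fintype.card V = (node t nil).size := by
      rw [← card_vert]
      exact Fintype.card_congr e.toEquiv
    rw [energy_congr e, energy_graph, hcard] at hE
    exact (iso_of_en_eq_size (by rintro ⟨⟩) hE).imp (fun ⟨f⟩ => ⟨e.trans f⟩) fun ⟨f⟩ => ⟨e.trans f⟩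
  · have : DecidableRel S₂.Adj := inferInstanceAs (DecidableRel (⊤ : SimpleGraph (Fin 2)).Adj)
    rintro (⟨⟨e⟩⟩ | ⟨⟨e⟩⟩)
    · obtain ⟨f⟩ := edge_iso_S₂
      refine ⟨e.isTree_iff.2 isTree_S₂, ?_, ?_⟩
      · rw [e.maxDegree_eq]
        refine S₂.maxDegree_le_of_forall_degree_le _ fun v => ?_
        exact ((S₂.degree_lt_card_verts v).le).trans (by simp)
      · rw [energy_congr e, ← energy_congr f, energy_graph, en_edge, Fintype.card_congr e.toEquiv]
        norm_num
    · obtain ⟨f⟩ := leafQ_iso_Q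
      refine ⟨e.isTree_iff.2 isTree_Q, ?_, ?_⟩
      · rw [e.maxDegree_eq]
        exact Q.maxDegree_le_of_forall_degree_le _ (by decide)
      · rw [energy_congr e, ← energy_congr f, energy_graph, en_leafQ, Fintype.card_congr e.toEquiv]
        norm_num
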